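/- For each $n\ge 1$ let $a_n\ge 1$ be an integer, $b_n>0$, and let $\xi_{1,n},\dots,\xi_{a_n,n}$ be i.i.d. real random variables with law $G_n$ and characteristic function $\theta_n$. Put $X_{k,n}=\xi_{k,n}/b_n$, $S_n=X_{1,n}+\dots+X_{a_n,n}$, let $F_n$ be the law of $X_{1,n}$, and set $$M_n(du)=a_n u^2F_n(du),\qquad \beta_n=\int_{\mathbb R}\sin u\,F_n(du).$$ A measure $M$ on $\mathbb R$ is *canonical* if it is finite on finite intervals and $M^{+}(x)=\int_x^{\infty}u^{-2}M(du)<\infty$, $M^-(x)=\int_{-\infty}^{-x}u^{-2}M(du)<\infty$ for all $x>0$. $M_n\to M$ *properly* means $M_n(I)\to M(I)$ for every finite interval $I$ whose endpoints are not atoms of $M$, and $M_n^{\pm}(x)\to M^{\pm}(x)$ for every $x>0$ such that $\pm x$ (respectively) is not an atom of $M$. For a canonical measure $M$ and $\beta\in\mathbb R$ let $$\phi(z)=\int_{\mathbb R}\frac{1-e^{izu}+iz\sin u}{u^2}\,M(du),\qquad \psi(z)=-i\beta z+\phi(z)$$ (the integrand is $z^2/2$ at $u=0$), and let $\phi_n$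 be defined as $\phi$ with $M_n$ in place of $M$. For a measure $m$ let $\hat m(A)=\tfrac12(m(A)+m(-A))$. Assume that $a_n\to\infty$, that $P\{|X_{1,n}|\ge\varepsilon\}\to0$ for every $\varepsilon>0$, that $M_n\to M$ properly and $a_n\beta_n\to\beta$ for some canonical measure $M$ and some $\beta\in\mathbb R$, and that: **A.** for every $n\ge1$, $\xi_{1,n}$ has a density $g_n$; **B.** there are $\alpha\in(0,2)$ and $c>0$ with $\operatorname{Re}\psi(z)\ge c|z|^\alpha$ for all sufficiently large $|z|$; **C.** $\sup_{n\ge1,\,|z|\ge\eta}|\theta_n(z)|<1$ for every $\eta>0$; **D.** $\sup_{n\ge1}\int_{\mathbb R} g_n^2(x)\,dx<\infty$; **E.** $b_n\to\infty$ and $(\ln b_n)/a_n\to0$; and that for some $\delta>0$: **F.** there are $c(\delta)>0$ and $\kappa\in(0,2)$, independent of $n$, such that for every $n\ge1$ either (a) $a_n\int_{\mathbb R}(1-\cos(zu))\,\hat F_n(du)\ge c(\delta)|z|^\kappa$ for all $|z|\le\delta b_n$, or (b) $\hat M\le\hat M_n$ as measures on $\mathbb R$; **G.** $\inf_{n\ge1,\,|z|\le\delta}|\operatorname{Re}\theta_n(z)|>0$.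 Assume moreover that each of the sequences $c_n=a_n$ and $c_n=b_n$ satisfies **H.** there are $s,t>0$ with $\liminf_{n\to\infty}c_n/n^{s}>0$ and $\limsup_{n\to\infty}c_n/n^{t}<\infty$. Put $$\gamma_n'=\sup_{z\in\mathbb R}\frac{|\operatorname{Re}\phi(z)-\operatorname{Re}\phi_n(z)|}{1+z^2},\quad \gamma_n''=\sup_{z\in\mathbb R}\frac{|\operatorname{Im}\phi(z)-\operatorname{Im}\phi_n(z)|}{1+z^2},\quad \chi_n=|a_n\beta_n-\beta|.$$ Then $S_n$ converges in distribution to a random variable $S$ with characteristic function $e^{-\psi}$; $S$ has a continuous density $p$; every $S_n$ has a density $p_n$, which may be taken continuous whenever $a_n\ge2$; and, for these continuous densities, there is a constant $C>0$ such that for all $n$ with $a_n\ge2$ (in particular for all sufficiently large $n$) $$\sup_{x\in\mathbb R}|p_n(x)-p(x)|\le C\max\Big(\gamma_n',\gamma_n'',\chi_n,\frac1{a_n}\Big).$$ -/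

import Mathlib

open MeasureTheory ProbabilityTheory Filter Topology
open scoped ENNReal

noncomputable section

namespace LocalLimit

/-- A canonical measure on `ℝ`: finite on finite intervals, with `u⁻²` integrable on
`(x, ∞)` and on `(-∞, -x)` for every `x > 0`. -/
structure IsCanonical (M : Measure ℝ) : Prop where
  finite_Icc : ∀ x y : ℝ, M (Set.Icc x y) < ⊤
  finite_right : ∀ x : ℝ, 0 < x → ∫⁻ u in Set.Ioi x, ENNReal.ofReal (1 / u ^ 2) ∂M < ⊤
  finite_left : ∀ x : ℝ, 0 < x → ∫⁻ u in Set.Iio (-x), ENNReal.ofReal (1 / u ^ 2) ∂M < ⊤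

/-- Proper convergence `Mn n → M` of canonical measures. As usual for weak-type convergence, the
intervals are those whose (finite) endpoints are not atoms of the limit `M`. -/
structure TendstoProperly (Mn : ℕ → Measure ℝ) (M : Measure ℝ) : Prop where
  interval : ∀ x y : ℝ, x < y → M {x} = 0 → M {y} = 0 →
    Tendsto (fun n => Mn n (Set.Ioc x y)) atTop (𝓝 (M (Set.Ioc x y)))
  right : ∀ x : ℝ, 0 < x → M {x} = 0 →
    Tendsto (fun n => ∫⁻ u in Set.Ioi x, ENNReal.ofReal (1 / u ^ 2) ∂(Mn n)) atTop
      (𝓝 (∫⁻ u in Set.Ioi x, ENNReal.ofReal (1 / u ^ 2) ∂M))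
  left : ∀ x : ℝ, 0 < x → M {-x} = 0 →
    Tendsto (fun n => ∫⁻ u in Set.Iio (-x), ENNReal.ofReal (1 / u ^ 2) ∂(Mn n)) atTop
      (𝓝 (∫⁻ u in Set.Iio (-x), ENNReal.ofReal (1 / u ^ 2) ∂M))

/-- The integrand `(1 - e^{izu} + i z sin u) / u²`, extended by continuity by `z² / 2` at `u = 0`. -/
def kernel (z u : ℝ) : ℂ :=
  if u = 0 then (z : ℂ) ^ 2 / 2
  else (1 - Complex.exp (Complex.I * z * u) + Complex.I * z * (Real.sin u : ℂ)) / (u : ℂ) ^ 2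

/-- `φ(z) = ∫ (1 - e^{izu} + i z sin u) / u² M(du)`. -/
def phi (M : Measure ℝ) (z : ℝ) : ℂ := ∫ u, kernel z u ∂M

/-- The characteristic exponent `ψ(z) = -iβz + φ(z)`. -/
def psi (M : Measure ℝ) (β z : ℝ) : ℂ := -Complex.I * β * z + phi M z

/-- The symmetrization `m̂(A) = (m(A) + m(-A)) / 2`. -/
def symm (m : Measure ℝ) : Measure ℝ := (2⁻¹ : ℝ≥0∞) • (m + m.map (fun u => -u))

/-- The law `F` of `ξ / b` when `G` is the law of `ξ`. -/
def scaledLaw (b : ℝ) (G : Measure ℝ) : Measure ℝ := G.map (fun u => u / b)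

/-- The measure `k u² F(du)`. -/
def arrayMeasure (k : ℕ) (F : Measure ℝ) : Measure ℝ :=
  F.withDensity (fun u => (k : ℝ≥0∞) * ENNReal.ofReal (u ^ 2))

/-- `∫ sin u F(du)`. -/
def sinMean (F : Measure ℝ) : ℝ := ∫ u, Real.sin u ∂F

/-- `γ' = sup_z |Re φ(z) - Re φ_n(z)| / (1 + z²)`, for the measures `M` and `M'` of `φ`, `φ_n`. -/
def gammaRe (M M' : Measure ℝ) : ℝ :=
  ⨆ z : ℝ, |(phi M z).re - (phi M' z).re| / (1 + z ^ 2)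

/-- `γ'' = sup_z |Im φ(z) - Im φ_n(z)| / (1 + z²)`. -/
def gammaIm (M M' : Measure ℝ) : ℝ :=
  ⨆ z : ℝ, |(phi M z).im - (phi M' z).im| / (1 + z ^ 2)

/-- `p` is a probability density of the measure `μ`. -/
structure IsDensity (μ : Measure ℝ) (p : ℝ → ℝ) : Prop where
  measurable : Measurable p
  nonneg : ∀ x, 0 ≤ p x
  eq_withDensity : μ = volume.withDensity (fun x => ENNReal.ofReal (p x))

/-- Condition B: `Re ψ(z) ≥ c |z|^α` for `|z|` large, with some `α ∈ (0, 2)` and `c > 0`. -/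
def CondB (M : Measure ℝ) (β : ℝ) : Prop :=
  ∃ α c R : ℝ, 0 < α ∧ α < 2 ∧ 0 < c ∧ ∀ z : ℝ, R ≤ |z| → c * |z| ^ α ≤ (psi M β z).re

/-- Condition C: for every `η > 0`, `|θ_n(z)|` is bounded away from `1` over all `n`, `|z| ≥ η`. -/
def CondC (G : ℕ → Measure ℝ) : Prop :=
  ∀ η : ℝ, 0 < η → ∃ N : ℝ, N < 1 ∧ ∀ (n : ℕ) (z : ℝ), η ≤ |z| → ‖charFun (G n) z‖ ≤ N

/-- Condition D: `sup_n ∫ g_n² < ∞`. -/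
def CondD (g : ℕ → ℝ → ℝ) : Prop :=
  (⨆ n, ∫⁻ x, ENNReal.ofReal (g n x ^ 2)) < ⊤

/-- Condition E: `b_n → ∞` and `(ln b_n) / a_n → 0`. -/
def CondE (a : ℕ → ℕ) (b : ℕ → ℝ) : Prop :=
  Tendsto b atTop atTop ∧ Tendsto (fun n => Real.log (b n) / a n) atTop (𝓝 0)

/-- Condition F at `δ`, with `F n` the law of `X_{1,n}`; `c` and `κ` do not depend on `n`. -/
def CondF (a : ℕ → ℕ) (b : ℕ → ℝ) (F : ℕ → Measure ℝ) (M : Measure ℝ) (δ : ℝ) : Prop :=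
  ∃ c κ : ℝ, 0 < c ∧ 0 < κ ∧ κ < 2 ∧ ∀ n : ℕ,
    (∀ z : ℝ, |z| ≤ δ * b n →
      c * |z| ^ κ ≤ a n * ∫ u, (1 - Real.cos (z * u)) ∂(symm (F n))) ∨
    symm M ≤ symm (arrayMeasure (a n) (F n))

/-- Condition G at `δ`: `|Re θ_n(z)|` is bounded away from `0` over all `n`, `|z| ≤ δ`. -/
def CondG (G : ℕ → Measure ℝ) (δ : ℝ) : Prop :=
  ∃ r : ℝ, 0 < r ∧ ∀ (n : ℕ) (z : ℝ), |z| ≤ δ → r ≤ |(charFun (G n) z).re|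

/-- Condition H for a sequence of positive numbers: `0 < liminf c_n / n^s` and
`limsup c_n / n^t < ∞` for some `s, t > 0` (in the extended half-line). -/
def CondH (c : ℕ → ℝ) : Prop :=
  ∃ s t : ℝ, 0 < s ∧ 0 < t ∧
    0 < liminf (fun n : ℕ => ENNReal.ofReal (c n / (n : ℝ) ^ s)) atTop ∧
    limsup (fun n : ℕ => ENNReal.ofReal (c n / (n : ℝ) ^ t)) atTop < ⊤

end LocalLimit

end

namespace LocalLimit

/-! By Fourier inversion, `sup |p_n - p|` is at most `(2π)⁻¹` times the L¹ distance between `θ_n(z /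
b_n) ^ a_n` and `e^{-ψ(z)}` (`abs_invDensity_sub_le`). Write `m_n` for the maximum of `γ_n'`,
`γ_n''`, `χ_n`, `1 / a_n`. The L¹ distance is split at `|z| = δ b_n` in
`eventually_integral_norm_sub_le`.

For `|z| ≤ δ b_n`, put `ψ_n = a_n (1 - θ_n(z / b_n))`, which is the exponent attached to `M_n` and
`a_n β_n` (`psi_arrayMeasure`). Replacing the power by `e^{-ψ_n}` costs `O(|ψ_n|² / a_n)`, and
replacing `ψ_n` by `ψ` costs `O(m_n (1 + z²))`. Both errors carry an exponentially small factor: B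
and F bound `Re ψ` and `Re ψ_n` below by a power of `|z|`, while C and G give `|θ_n| ≤ exp(-c (1 -
Re θ_n))` with `c` independent of `n` (`exists_one_sub_charFun_re_le`), so the power itself decays
like `e^{-c Re ψ_n}`. The error is thus `O(m_n / (1 + z²))`.

For `|z| > δ b_n`, C gives `|θ_n| ≤ N < 1`. Two factors are kept for Plancherel, where D bounds `∫
|θ_n|²`, and E makes the remaining `N ^ (a_n - 2) b_n` of order `1 / a_n`. The tail of `e^{-ψ}`
beats every power of `b_n`, hence `a_n` as well by H.

The limit law comes from Lévy's continuity theorem, the densities from an inversion theorem proved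
by Gaussian smoothing. -/

/-! ### Gaussian smoothing and the Plancherel inequality. -/

lemma integral_cexp_mul_gaussian {v : NNReal} (hv : v ≠ 0) (x y : ℝ) :
    ∫ z : ℝ, Complex.exp (Complex.I * (y - x) * z) * Complex.exp (-(v / 2) * (z : ℂ) ^ 2) =
      ((2 * Real.pi * gaussianPDFReal x v y : ℝ) : ℂ) := by
  have hv' : (0 : ℝ) < v := by positivity
  have h := fourierIntegral_gaussian (b := (v / 2 : ℂ)) (by simpa using hv') ((y - x : ℝ) : ℂ)
  have h2 : (Real.pi / (v / 2 : ℂ)) ^ (1 / 2 : ℂ) = ((√(2 * Real.pi / v) : ℝ) : ℂ) := by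
    rw [Real.sqrt_eq_rpow, Complex.ofReal_cpow (by positivity)]
    push_cast
    congr 1
    field_simp
  have h3 : √(2 * Real.pi / v) = 2 * Real.pi * (√(2 * Real.pi * v))⁻¹ := by
    rw [Real.sqrt_eq_iff_mul_self_eq (by positivity) (by positivity)]
    have := Real.mul_self_sqrt (show 0 ≤ 2 * Real.pi * (v : ℝ) by positivity)
    field_simp
    rw [Real.sq_sqrt (by positivity)]
  rw [h2] at h
  push_cast at h
  rw [h, h3, gaussianPDFReal_def]
  push_cast
  ring_nf

lemma integrable_gaussian_complex {v : NNReal} (hv : v ≠ 0) :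
    Integrable (fun z : ℝ => Complex.exp (-(v / 2) * (z : ℂ) ^ 2)) := by
  have hv' : (0 : ℝ) < v := by positivity
  exact integrable_cexp_neg_mul_sq (b := (v / 2 : ℂ)) (by simpa using hv')

/-- Fubini: damping the characteristic function by `e^{-v z² / 2}` amounts to smoothing the law by a
Gaussian of variance `v`. Both Plancherel and inversion follow by letting `v → 0`. -/
lemma integral_charFun_mul_gaussian (ν : Measure ℝ) [IsFiniteMeasure ν] {v : NNReal} (hv : v ≠ 0)
    (x : ℝ) :
    ∫ z : ℝ, charFun ν z * Complex.exp (-Complex.I * z * x) *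
        Complex.exp (-(v / 2) * (z : ℂ) ^ 2) =
      ((2 * Real.pi * ∫ y, gaussianPDFReal x v y ∂ν : ℝ) : ℂ) := by
  have hG := integrable_gaussian_complex hv
  have hint : Integrable (Function.uncurry fun z y : ℝ =>
      Complex.exp (Complex.I * (y - x) * z) * Complex.exp (-(v / 2) * (z : ℂ) ^ 2))
      (volume.prod ν) := by
    have h1 : Integrable (fun p : ℝ × ℝ => Complex.exp (-(v / 2) * (p.1 : ℂ) ^ 2))
        (volume.prod ν) := hG.comp_fst ν
    refine h1.mono (by fun_prop) (ae_of_all _ fun p => ?_)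
    simp only [Function.uncurry, norm_mul]
    have : Complex.I * (p.2 - x) * p.1 = Complex.I * ((p.2 - x) * p.1 : ℝ) := by
      push_cast; ring
    rw [this, mul_comm Complex.I, Complex.norm_exp_ofReal_mul_I, one_mul]
  have h2 : ∀ z : ℝ, charFun ν z * Complex.exp (-Complex.I * z * x) *
        Complex.exp (-(v / 2) * (z : ℂ) ^ 2) = ∫ y : ℝ, Complex.exp (Complex.I * (y - x) * z) *
          Complex.exp (-(v / 2) * (z : ℂ) ^ 2) ∂ν := by
    intro z
    rw [charFun_apply_real, integral_mul_const, ← integral_mul_const]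
    congr 2
    ext y
    rw [← Complex.exp_add]
    ring_nf
  simp_rw [h2]
  rw [integral_integral_swap hint]
  simp_rw [integral_cexp_mul_gaussian hv x]
  rw [integral_complex_ofReal, integral_const_mul]

lemma gaussianPDF_comm (v : NNReal) (x y : ℝ) :
    gaussianPDF x v y = gaussianPDF y v x := by
  rw [gaussianPDF, gaussianPDF, gaussianPDFReal_def, gaussianPDFReal_def]
  simp only [sub_sq_comm y x]

lemma measurable_gaussianPDF_prod (v : NNReal) :
    Measurable fun p : ℝ × ℝ => gaussianPDF p.2 v p.1 := by
  simp only [gaussianPDF, gaussianPDFReal_def]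
  fun_prop

lemma measurable_gaussianPDF_mean (v : NNReal) (x : ℝ) : Measurable fun y => gaussianPDF y v x := by
  simp only [gaussianPDF, gaussianPDFReal_def]
  fun_prop

lemma ofReal_integral_gaussianPDFReal (ν : Measure ℝ) [IsFiniteMeasure ν] (x : ℝ) (v : NNReal) :
    ENNReal.ofReal (∫ y, gaussianPDFReal x v y ∂ν) = ∫⁻ y, gaussianPDF x v y ∂ν := by
  rw [ofReal_integral_eq_lintegral_ofReal]
  · rfl
  · refine Integrable.of_bound (by
      exact (measurable_gaussianPDFReal x v).aestronglyMeasurable) ((√(2 * Real.pi * v))⁻¹)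
      (ae_of_all _ fun y => ?_)
    rw [Real.norm_of_nonneg (gaussianPDFReal_nonneg _ _ _), gaussianPDFReal_def]
    refine mul_le_of_le_one_right (by positivity) (Real.exp_le_one_iff.2 ?_)
    rw [neg_div]
    have : 0 ≤ (y - x) ^ 2 / (2 * (v : ℝ)) := by positivity
    linarith
  · exact ae_of_all _ fun y => gaussianPDFReal_nonneg _ _ _

/-- Use `g(x) g(y) ≤ (g(x)² + g(y)²) / 2`; the Gaussian kernel is symmetric and has mass one in
either variable. -/
lemma lintegral_mul_gaussianPDF_le {g : ℝ → ℝ} (hg : Measurable g) (hg0 : ∀ x, 0 ≤ g x)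
    {v : NNReal} (hv : v ≠ 0) :
    ∫⁻ x, ENNReal.ofReal (g x) * ∫⁻ y, ENNReal.ofReal (g y) * gaussianPDF y v x ≤
      ∫⁻ x, ENNReal.ofReal (g x ^ 2) := by
  have hgm : Measurable fun x => ENNReal.ofReal (g x) := hg.ennreal_ofReal
  have hm2 := measurable_gaussianPDF_prod v
  have h6 : ∀ x y, ENNReal.ofReal (g x) * (ENNReal.ofReal (g y) * gaussianPDF y v x) ≤
      2⁻¹ * (ENNReal.ofReal (g x ^ 2) * gaussianPDF x v y) +
        2⁻¹ * (ENNReal.ofReal (g y ^ 2) * gaussianPDF y v x) := by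
    intro x y
    rw [gaussianPDF_comm v x y, ← mul_assoc, ← mul_assoc, ← mul_assoc, ← add_mul]
    gcongr
    rw [← ENNReal.ofReal_mul (hg0 x), ← mul_add,
      ← ENNReal.ofReal_add (by positivity) (by positivity)]
    rw [show (2⁻¹ : ℝ≥0∞) = ENNReal.ofReal 2⁻¹ by
      rw [ENNReal.ofReal_inv_of_pos two_pos]; simp, ← ENNReal.ofReal_mul (by positivity)]
    apply ENNReal.ofReal_le_ofReal
    nlinarith [sq_nonneg (g x - g y)]
  have hg2 : Measurable fun x => ENNReal.ofReal (g x ^ 2) :=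
    (hg.pow_const 2).ennreal_ofReal
  have hm4 : ∀ x, Measurable fun y => gaussianPDF x v y := fun x => measurable_gaussianPDF x v
  have hm5 : ∀ x, Measurable fun y => gaussianPDF y v x := measurable_gaussianPDF_mean v
  calc ∫⁻ x, ENNReal.ofReal (g x) * ∫⁻ y, ENNReal.ofReal (g y) * gaussianPDF y v x
      = ∫⁻ x, ∫⁻ y, ENNReal.ofReal (g x) * (ENNReal.ofReal (g y) * gaussianPDF y v x) := by
        congr 1
        ext x
        exact (lintegral_const_mul _ (hgm.mul (hm5 x))).symm
    _ ≤ ∫⁻ x, ∫⁻ y, (2⁻¹ * (ENNReal.ofReal (g x ^ 2) * gaussianPDF x v y) +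
        2⁻¹ * (ENNReal.ofReal (g y ^ 2) * gaussianPDF y v x)) :=
      lintegral_mono fun x => lintegral_mono fun y => h6 x y
    _ = ∫⁻ x, (2⁻¹ * ENNReal.ofReal (g x ^ 2) +
        2⁻¹ * ∫⁻ y, ENNReal.ofReal (g y ^ 2) * gaussianPDF y v x) := by
      congr 1
      ext x
      rw [lintegral_add_left (((hm4 x).const_mul _).const_mul _),
        lintegral_const_mul _ ((hm4 x).const_mul _), lintegral_const_mul _ (hm4 x),
        lintegral_gaussianPDF_eq_one x hv, mul_one]
      exact congrArg _ (lintegral_const_mul _ (hg2.mul (hm5 x)))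
    _ = 2⁻¹ * (∫⁻ x, ENNReal.ofReal (g x ^ 2)) + 2⁻¹ * ∫⁻ x, ENNReal.ofReal (g x ^ 2) := by
      have hm6 : Measurable fun p : ℝ × ℝ => ENNReal.ofReal (g p.2 ^ 2) * gaussianPDF p.2 v p.1 :=
        (hg2.comp measurable_snd).mul hm2
      rw [lintegral_add_left (hg2.const_mul _), lintegral_const_mul _ hg2,
        lintegral_const_mul _ (Measurable.lintegral_prod_right' hm6),
        lintegral_lintegral_swap hm6.aemeasurable]
      congr 2
      congr 1
      ext y
      dsimp only
      rw [lintegral_const_mul _ (hm4 y), lintegral_gaussianPDF_eq_one y hv, mul_one]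
    _ = ∫⁻ x, ENNReal.ofReal (g x ^ 2) := by
      rw [← add_mul, ENNReal.inv_two_add_inv_two, one_mul]
/-- Half of Plancherel's theorem for a probability density. -/
lemma lintegral_normSq_charFun_le {G : Measure ℝ} [IsProbabilityMeasure G] {g : ℝ → ℝ}
    (hg : IsDensity G g) :
    ∫⁻ z, ENNReal.ofReal (‖charFun G z‖ ^ 2) ≤
      ENNReal.ofReal (2 * Real.pi) * ∫⁻ x, ENNReal.ofReal (g x ^ 2) := by
  -- The law of the difference of two independent copies; its characteristic function is `|θ|²`, so
  -- the damped integral of `|θ|²` is a Gaussian average of `ν`.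
  set ν : Measure ℝ := G ∗ G.map (fun u => -u) with hν
  have : IsProbabilityMeasure (G.map (fun u : ℝ => -u)) :=
    Measure.isProbabilityMeasure_map (by fun_prop)
  have hchar : ∀ z, charFun ν z = ((‖charFun G z‖ ^ 2 : ℝ) : ℂ) := by
    intro z
    have : charFun (G.map (fun u : ℝ => -u)) z = charFun G (-z) := by
      have := charFun_map_mul (μ := G) (-1) z
      simpa using this
    rw [hν, charFun_conv, this, charFun_neg, Complex.mul_conj, Complex.normSq_eq_norm_sq]
  have hgm : Measurable fun x => ENNReal.ofReal (g x) := hg.measurable.ennreal_ofReal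
  -- the bound for the integral against a Gaussian
  have key : ∀ v : NNReal, v ≠ 0 →
      ∫⁻ z, ENNReal.ofReal (‖charFun G z‖ ^ 2 * Real.exp (-(v / 2) * z ^ 2)) ≤
        ENNReal.ofReal (2 * Real.pi) * ∫⁻ x, ENNReal.ofReal (g x ^ 2) := by
    intro v hv
    have h1 := integral_charFun_mul_gaussian ν hv 0
    have h2 : ∫ z, ‖charFun G z‖ ^ 2 * Real.exp (-(v / 2) * z ^ 2) =
        2 * Real.pi * ∫ y, gaussianPDFReal 0 v y ∂ν := by
      rw [← Complex.ofReal_inj, ← h1, ← integral_complex_ofReal]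
      congr 1
      ext z
      rw [hchar]
      push_cast
      simp
    have hcont : Continuous fun z => charFun G z := continuous_charFun
    have hint : Integrable fun z => ‖charFun G z‖ ^ 2 * Real.exp (-(v / 2) * z ^ 2) := by
      refine (integrable_exp_neg_mul_sq (b := (v / 2 : ℝ)) (by positivity)).mono
        (by fun_prop) (ae_of_all _ fun z => ?_)
      rw [norm_mul, norm_pow, norm_norm]
      have := norm_charFun_le_one (μ := G) z
      exact mul_le_of_le_one_left (norm_nonneg _) (pow_le_one₀ (norm_nonneg _) this)
    rw [← ofReal_integral_eq_lintegral_ofReal hint (ae_of_all _ fun z => by positivity), h2,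
      ENNReal.ofReal_mul (by positivity)]
    gcongr
    have hpdf : Measurable (gaussianPDF 0 v) := measurable_gaussianPDF 0 v
    have hshift : ∀ x y : ℝ, gaussianPDF 0 v (x + -y) = gaussianPDF y v x := by
      intro x y
      simp only [gaussianPDF, gaussianPDFReal_def]
      ring_nf
    have hm2 := measurable_gaussianPDF_prod v
    have h4 : ∫⁻ y, gaussianPDF 0 v y ∂ν = ∫⁻ x, ∫⁻ y, gaussianPDF y v x ∂G ∂G := by
      rw [hν, Measure.lintegral_conv hpdf]
      congr 1
      ext x
      rw [lintegral_map (by fun_prop) (by fun_prop)]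
      simp_rw [hshift]
    rw [ofReal_integral_gaussianPDFReal, h4]
    have h5 : ∀ x, ∫⁻ y, gaussianPDF y v x ∂G
        = ∫⁻ y, ENNReal.ofReal (g y) * gaussianPDF y v x := by
      intro x
      conv_lhs => rw [hg.eq_withDensity]
      rw [lintegral_withDensity_eq_lintegral_mul _ hgm (measurable_gaussianPDF_mean v x)]
      rfl
    simp_rw [h5]
    have hm3 : Measurable fun x => ∫⁻ y, ENNReal.ofReal (g y) * gaussianPDF y v x := by
      refine Measurable.lintegral_prod_right' (f := fun p : ℝ × ℝ =>
        ENNReal.ofReal (g p.2) * gaussianPDF p.2 v p.1) ?_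
      exact (hgm.comp measurable_snd).mul hm2
    conv_lhs => rw [hg.eq_withDensity]
    rw [lintegral_withDensity_eq_lintegral_mul _ hgm hm3]
    simp only [Pi.mul_apply]
    exact lintegral_mul_gaussianPDF_le hg.measurable hg.nonneg hv
  have hlim : ∀ z : ℝ, liminf (fun k : ℕ => ENNReal.ofReal (‖charFun G z‖ ^ 2 *
      Real.exp (-((((k : NNReal) + 1)⁻¹ : NNReal) / 2) * z ^ 2))) atTop
      = ENNReal.ofReal (‖charFun G z‖ ^ 2) := by
    intro z
    apply Tendsto.liminf_eq
    apply ENNReal.tendsto_ofReal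
    have h1 : Tendsto (fun k : ℕ => (((k : ℝ) + 1)⁻¹)) atTop (𝓝 0) := by
      simpa using tendsto_one_div_add_atTop_nhds_zero_nat (𝕜 := ℝ)
    have h2 : Tendsto (fun k : ℕ => ‖charFun G z‖ ^ 2 *
      Real.exp (-((((k : ℝ) + 1)⁻¹) / 2) * z ^ 2)) atTop
        (𝓝 (‖charFun G z‖ ^ 2 * Real.exp (-(0 / 2) * z ^ 2))) := by
      refine Tendsto.const_mul _ ((Real.continuous_exp.tendsto _).comp ?_)
      exact ((h1.div_const 2).neg).mul_const _
    simpa using h2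
  have hcont : Continuous fun z => charFun G z := continuous_charFun
  -- Fatou's lemma along the variances `1 / (k + 1)` removes the damping.
  calc ∫⁻ z, ENNReal.ofReal (‖charFun G z‖ ^ 2)
      = ∫⁻ z, liminf (fun k : ℕ => ENNReal.ofReal (‖charFun G z‖ ^ 2 *
        Real.exp (-((((k : NNReal) + 1)⁻¹ : NNReal) / 2) * z ^ 2))) atTop := by
        simp_rw [hlim]
    _ ≤ liminf (fun k : ℕ => ∫⁻ z, ENNReal.ofReal (‖charFun G z‖ ^ 2 *
        Real.exp (-((((k : NNReal) + 1)⁻¹ : NNReal) / 2) * z ^ 2))) atTop :=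
      lintegral_liminf_le fun k => by fun_prop
    _ ≤ _ := by
      refine liminf_le_of_le (by isBoundedDefault) fun c hc => ?_
      obtain ⟨k, hk⟩ := hc.exists
      exact hk.trans (key _ (by positivity))

/-! ### Fourier inversion for integrable characteristic functions. -/

/-- The function `x ↦ (2π)⁻¹ ∫ e^{-izx} χ(z) dz` (its real part). -/
noncomputable def invDensity (χ : ℝ → ℂ) (x : ℝ) : ℝ :=
  (2 * Real.pi)⁻¹ * (∫ z : ℝ, χ z * Complex.exp (-Complex.I * z * x)).re

lemma norm_cexp_neg_I_mul (z x : ℝ) : ‖Complex.exp (-Complex.I * z * x)‖ = 1 := by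
  have : -Complex.I * z * x = ((-(z * x) : ℝ) : ℂ) * Complex.I := by push_cast; ring
  rw [this, Complex.norm_exp_ofReal_mul_I]

lemma integrable_mul_cexp {χ : ℝ → ℂ} (hχ : Integrable χ) (x : ℝ) :
    Integrable fun z : ℝ => χ z * Complex.exp (-Complex.I * z * x) := by
  refine hχ.mono (hχ.aestronglyMeasurable.mul (by fun_prop)) (ae_of_all _ fun z => ?_)
  rw [norm_mul, norm_cexp_neg_I_mul, mul_one]

lemma continuous_invDensity {χ : ℝ → ℂ} (hχ : Integrable χ) : Continuous (invDensity χ) := by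
  unfold invDensity
  refine continuous_const.mul (Complex.continuous_re.comp ?_)
  refine continuous_of_dominated (fun x => (integrable_mul_cexp hχ x).aestronglyMeasurable)
    (bound := fun z => ‖χ z‖) (fun x => ae_of_all _ fun z => ?_) hχ.norm
    (ae_of_all _ fun z => by fun_prop)
  rw [norm_mul, norm_cexp_neg_I_mul, mul_one]

/-- The source of the uniform estimate: the bound does not depend on `x`. -/
lemma abs_invDensity_sub_le {χ χ' : ℝ → ℂ} (hχ : Integrable χ) (hχ' : Integrable χ') (x : ℝ) :
    |invDensity χ x - invDensity χ' x| ≤ (2 * Real.pi)⁻¹ * ∫ z, ‖χ z - χ' z‖ := by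
  unfold invDensity
  rw [← mul_sub, ← Complex.sub_re, ← integral_sub (integrable_mul_cexp hχ x)
    (integrable_mul_cexp hχ' x), abs_mul, abs_of_pos (by positivity : 0 < (2 * Real.pi)⁻¹)]
  gcongr
  refine (Complex.abs_re_le_norm _).trans ((norm_integral_le_integral_norm _).trans_eq ?_)
  congr 1
  ext z
  rw [← sub_mul, norm_mul, norm_cexp_neg_I_mul, mul_one]

/-- Gaussian smoothings of a law with integrable characteristic function converge pointwise to
its inverse Fourier transform. -/
lemma tendsto_integral_gaussianPDFReal {μ : Measure ℝ} [IsProbabilityMeasure μ]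
    (hμ : Integrable (charFun μ)) (x : ℝ) :
    Tendsto (fun k : ℕ => ((∫ y, gaussianPDFReal x ((k : NNReal) + 1)⁻¹ y ∂μ : ℝ) : ℂ)) atTop
      (𝓝 (((2 * Real.pi)⁻¹ : ℝ) * ∫ z : ℝ, charFun μ z * Complex.exp (-Complex.I * z * x))) := by
  have h1 : ∀ k : ℕ, ((∫ y, gaussianPDFReal x ((k : NNReal) + 1)⁻¹ y ∂μ : ℝ) : ℂ) =
      ((2 * Real.pi)⁻¹ : ℝ) * ∫ z : ℝ, charFun μ z * Complex.exp (-Complex.I * z * x) *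
        Complex.exp (-((((k : NNReal) + 1)⁻¹ : NNReal) / 2) * (z : ℂ) ^ 2) := by
    intro k
    rw [integral_charFun_mul_gaussian μ (by positivity) x, ← Complex.ofReal_mul, ← mul_assoc,
      inv_mul_cancel₀ (by positivity), one_mul]
  simp_rw [h1]
  refine Tendsto.const_mul _ ?_
  have hlim : Tendsto (fun k : ℕ => (((k : ℝ) + 1)⁻¹)) atTop (𝓝 0) := by
    simpa using tendsto_one_div_add_atTop_nhds_zero_nat (𝕜 := ℝ)
  refine tendsto_integral_of_dominated_convergence (fun z => ‖charFun μ z‖)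
    (fun k => ((integrable_mul_cexp hμ x).aestronglyMeasurable.mul (by fun_prop))) hμ.norm
    (fun k => ae_of_all _ fun z => ?_) (ae_of_all _ fun z => ?_)
  · rw [norm_mul, norm_mul, norm_cexp_neg_I_mul, mul_one]
    refine mul_le_of_le_one_right (norm_nonneg _) ?_
    rw [Complex.norm_exp, Real.exp_le_one_iff]
    have : (-((((k : NNReal) + 1)⁻¹ : NNReal) / 2 : ℂ) * (z : ℂ) ^ 2) =
      ((-(((k : ℝ) + 1)⁻¹ / 2 * z ^ 2) : ℝ) : ℂ) := by push_cast; ring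
    rw [this, Complex.ofReal_re, neg_nonpos]
    positivity
  · have h2 : Tendsto (fun k : ℕ => (((((k : ℝ) + 1)⁻¹ : ℝ)) : ℂ)) atTop (𝓝 ((0 : ℝ) : ℂ)) :=
      (Complex.continuous_ofReal.tendsto _).comp hlim
    have h3 : Tendsto (fun k : ℕ => charFun μ z * Complex.exp (-Complex.I * z * x) *
        Complex.exp (-(((((k : ℝ) + 1)⁻¹ : ℝ) : ℂ) / 2) * (z : ℂ) ^ 2)) atTop
        (𝓝 (charFun μ z * Complex.exp (-Complex.I * z * x) *
          Complex.exp (-(((0 : ℝ) : ℂ) / 2) * (z : ℂ) ^ 2))) :=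
      Tendsto.const_mul _ ((Complex.continuous_exp.tendsto _).comp
        (((h2.div_const 2).neg).mul_const _))
    simpa using h3

/-- A probability measure with integrable characteristic function has a continuous density, given
by Fourier inversion. -/
theorem isDensity_invDensity {μ : Measure ℝ} [IsProbabilityMeasure μ]
    (hμ : Integrable (charFun μ)) : IsDensity μ (invDensity (charFun μ)) := by
  set q := invDensity (charFun μ) with hq
  have hqc : Continuous q := continuous_invDensity hμ
  have hre : ∀ x, Tendsto (fun k : ℕ => ∫ y, gaussianPDFReal x ((k : NNReal) + 1)⁻¹ y ∂μ) atTop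
      (𝓝 (q x)) := by
    intro x
    have := (Complex.continuous_re.tendsto _).comp (tendsto_integral_gaussianPDFReal hμ x)
    rw [Complex.re_ofReal_mul] at this
    exact this
  -- The inversion integral is a limit of real numbers, so nothing was lost by taking its real part
  -- in `invDensity`.
  have hcomplex : ∀ x, (q x : ℂ) =
      ((2 * Real.pi)⁻¹ : ℝ) * ∫ z : ℝ, charFun μ z * Complex.exp (-Complex.I * z * x) := fun x =>
    tendsto_nhds_unique ((Complex.continuous_ofReal.tendsto _).comp (hre x))
      (tendsto_integral_gaussianPDFReal hμ x)
  have hq0 : ∀ x, 0 ≤ q x := fun x =>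
    ge_of_tendsto' (hre x) fun k => integral_nonneg fun y => gaussianPDFReal_nonneg _ _ _
  -- Fatou bounds the mass of `q` by one. The resulting integrability is what the Fourier inversion
  -- theorem requires below.
  have hmass : ∫⁻ x, ENNReal.ofReal (q x) ≤ 1 := by
    have h1 : ∀ x, liminf (fun k : ℕ => ∫⁻ y, gaussianPDF x ((k : NNReal) + 1)⁻¹ y ∂μ) atTop
        = ENNReal.ofReal (q x) := by
      intro x
      refine Tendsto.liminf_eq ?_
      simp_rw [← ofReal_integral_gaussianPDFReal]
      exact ENNReal.tendsto_ofReal (hre x)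
    have hm : ∀ v, Measurable fun p : ℝ × ℝ => gaussianPDF p.1 v p.2 := fun v => by
      simp only [gaussianPDF, gaussianPDFReal_def]
      fun_prop
    simp_rw [← h1]
    refine (lintegral_liminf_le fun k => Measurable.lintegral_prod_right' (hm _)).trans ?_
    refine liminf_le_of_le (by isBoundedDefault) fun c hc => ?_
    obtain ⟨k, hk⟩ := hc.exists
    refine hk.trans_eq ?_
    rw [lintegral_lintegral_swap (hm _).aemeasurable]
    simp_rw [fun x y => gaussianPDF_comm ((k : NNReal) + 1)⁻¹ x y]
    simp_rw [lintegral_gaussianPDF_eq_one _ (show ((k : NNReal) + 1)⁻¹ ≠ 0 by positivity)]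
    simp
  have hqint : Integrable q := by
    refine ⟨hqc.aestronglyMeasurable, ?_⟩
    rw [hasFiniteIntegral_iff_ofReal (ae_of_all _ hq0)]
    exact hmass.trans_lt ENNReal.one_lt_top
  refine ⟨hqc.measurable, hq0, ?_⟩
  have hfin : IsFiniteMeasure (volume.withDensity fun x => ENNReal.ofReal (q x)) :=
    isFiniteMeasure_withDensity_ofReal hqint.2
  -- Characteristic functions separate finite measures, so the total mass of `q` need not be known
  -- to equal one.
  refine Measure.ext_of_charFun (funext fun t => ?_)
  -- Fourier inversion for `h w = χ(2πw)`, whose Fourier transform is `q`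
  set h : ℝ → ℂ := fun w => charFun μ (2 * Real.pi * w) with hh
  have hχc : Continuous (charFun μ) := continuous_charFun
  have hhc : Continuous h := by fun_prop
  have hhi : Integrable h := hμ.comp_mul_left' (by positivity)
  have hF : Real.instFourierTransform.fourier h = fun x => (q x : ℂ) := by
    ext x
    rw [hcomplex, Real.fourier_eq']
    have := Measure.integral_comp_mul_left
      (fun z : ℝ => charFun μ z * Complex.exp (-Complex.I * z * x)) (2 * Real.pi)
    rw [abs_of_pos (by positivity), Complex.real_smul] at this
    rw [← this]
    congr 1
    ext w
    simp only [hh, smul_eq_mul]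
    rw [mul_comm]
    congr 2
    simp
    ring
  have hinv := hhc.fourierInv_fourier_eq hhi (by
    show Integrable (Real.instFourierTransform.fourier h)
    rw [hF]; exact hqint.ofReal)
  have h2 := congrFun hinv (t / (2 * Real.pi))
  change Real.instFourierTransformInv.fourierInv (Real.instFourierTransform.fourier h) _ = _ at h2
  rw [hF, Real.fourierInv_eq'] at h2
  simp only [hh] at h2
  rw [mul_div_cancel₀ _ (by positivity)] at h2
  rw [← h2, charFun_apply_real, integral_withDensity_eq_integral_toReal_smul
    (hqc.measurable.ennreal_ofReal) (by simp)]
  congr 1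
  ext x
  rw [ENNReal.toReal_ofReal (hq0 x), Complex.real_smul, smul_eq_mul, mul_comm]
  congr 2
  simp
  field_simp

/-! ### Bounds and continuity of the kernel. -/

lemma kernel_zero (z : ℝ) : kernel z 0 = (z : ℂ) ^ 2 / 2 := by simp [kernel]

lemma kernel_of_ne (z : ℝ) {u : ℝ} (hu : u ≠ 0) :
    kernel z u = (1 - Complex.exp (Complex.I * z * u) + Complex.I * z * (Real.sin u : ℂ)) /
      (u : ℂ) ^ 2 := by simp [kernel, hu]

lemma norm_cexp_I_mul (z u : ℝ) : ‖Complex.exp (Complex.I * z * u)‖ = 1 := by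
  have : Complex.I * z * u = ((z * u : ℝ) : ℂ) * Complex.I := by push_cast; ring
  rw [this, Complex.norm_exp_ofReal_mul_I]

lemma continuous_kernel_left (u : ℝ) : Continuous fun z => kernel z u := by
  by_cases hu : u = 0
  · subst hu; simp only [kernel_zero]; fun_prop
  · simp only [kernel_of_ne _ hu]; fun_prop

lemma norm_cexp_I_sub_one_sub_le (x : ℝ) :
    ‖Complex.exp (Complex.I * x) - 1 - Complex.I * x‖ ≤ 3 * x ^ 2 := by
  have hn : ‖Complex.I * (x : ℂ)‖ = |x| := by
    rw [norm_mul, Complex.norm_I, one_mul, Complex.norm_real, Real.norm_eq_abs]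
  rcases le_or_gt |x| 1 with hx | hx
  · have h := Complex.norm_exp_sub_one_sub_id_le (x := Complex.I * x) (hn.trans_le hx)
    rw [hn, sq_abs] at h
    nlinarith [sq_nonneg x]
  · have h1 : |x| ≤ x ^ 2 := by rw [← sq_abs]; nlinarith
    have h2 : 1 ≤ x ^ 2 := by rw [← sq_abs]; nlinarith
    have h3 : ‖Complex.exp (Complex.I * x)‖ = 1 := Complex.norm_exp_I_mul_ofReal x
    calc _ ≤ ‖Complex.exp (Complex.I * x)‖ + ‖(1 : ℂ)‖ + ‖Complex.I * (x : ℂ)‖ :=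
          (norm_sub_le _ _).trans (add_le_add_left (norm_sub_le _ _) _)
      _ ≤ _ := by rw [h3, hn, norm_one]; linarith

lemma abs_sub_sin_le {u : ℝ} (hu : |u| ≤ 1) : |u - Real.sin u| ≤ |u| ^ 3 := by
  have h := Real.sin_bound hu
  have h5 : |u| ^ 5 ≤ |u| ^ 3 := pow_le_pow_of_le_one (abs_nonneg _) hu (by norm_num)
  have h3 : |u ^ 3 / 6| = |u| ^ 3 / 6 := by rw [abs_div, abs_pow]; norm_num
  have : u - Real.sin u = u ^ 3 / 6 - (Real.sin u - (u - u ^ 3 / 6)) := by ring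
  rw [this]
  refine (abs_sub _ _).trans ?_
  rw [h3]
  have : 0 ≤ |u| ^ 3 := by positivity
  linarith

/-- For `|u| ≤ 1` the sine compensates the linear term up to `z (u - sin u)`, leaving a numerator of
order `(z² + |z|) u²`; for `|u| > 1` the numerator is at most `2 + |z|`. The weight `(1 + u²)⁻¹` is
integrable for every canonical measure. -/
lemma norm_kernel_le (z u : ℝ) : ‖kernel z u‖ ≤ 8 * (1 + z ^ 2) * (1 + u ^ 2)⁻¹ := by
  rw [← div_eq_mul_inv]
  by_cases hu : u = 0
  · subst hu
    rw [kernel_zero]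
    simp only [norm_div, norm_pow, Complex.norm_real, Real.norm_eq_abs, sq_abs]
    norm_num
    nlinarith [sq_nonneg z]
  have hu2 : 0 < u ^ 2 := by positivity
  have hz : |z| ≤ (1 + z ^ 2) / 2 := by
    rw [← sq_abs z]; nlinarith [sq_nonneg (|z| - 1)]
  rw [kernel_of_ne z hu, norm_div, norm_pow, Complex.norm_real, Real.norm_eq_abs, sq_abs]
  rw [div_le_div_iff₀ hu2 (by positivity)]
  by_cases h1 : |u| ≤ 1
  · have hu1 : u ^ 2 ≤ 1 := by rw [← sq_abs]; exact pow_le_one₀ (abs_nonneg _) h1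
    have e1 := norm_cexp_I_sub_one_sub_le (z * u)
    have e2 := abs_sub_sin_le h1
    have e3 : |u| ^ 3 ≤ u ^ 2 := by
      rw [← sq_abs u]; exact pow_le_pow_of_le_one (abs_nonneg _) h1 (by norm_num)
    have : ‖1 - Complex.exp (Complex.I * z * u) + Complex.I * z * (Real.sin u : ℂ)‖ ≤
        3 * (z * u) ^ 2 + |z| * u ^ 2 := by
      have : 1 - Complex.exp (Complex.I * z * u) + Complex.I * z * (Real.sin u : ℂ) =
        -(Complex.exp (Complex.I * (z * u : ℝ)) - 1 - Complex.I * (z * u : ℝ)) -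
          Complex.I * (z * (u - Real.sin u) : ℝ) := by push_cast; ring_nf
      rw [this]
      refine (norm_sub_le _ _).trans ?_
      rw [norm_neg, norm_mul, Complex.norm_I, one_mul, Complex.norm_real, Real.norm_eq_abs, abs_mul]
      gcongr
      exact e2.trans e3
    calc _ ≤ (3 * (z * u) ^ 2 + |z| * u ^ 2) * (1 + u ^ 2) := by gcongr
      _ ≤ (3 * (z ^ 2 * u ^ 2) + (1 + z ^ 2) / 2 * u ^ 2) * (1 + 1) := by
        rw [mul_pow]; gcongr
      _ ≤ _ := by nlinarith [mul_nonneg (sq_nonneg z) hu2.le]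
  · push Not at h1
    have hu1 : 1 ≤ u ^ 2 := by rw [← sq_abs]; exact one_le_pow₀ h1.le
    have : ‖1 - Complex.exp (Complex.I * z * u) + Complex.I * z * (Real.sin u : ℂ)‖ ≤
        1 + 1 + |z| := by
      refine (norm_add_le _ _).trans (add_le_add ((norm_sub_le _ _).trans ?_) ?_)
      · rw [norm_cexp_I_mul, norm_one]
      · rw [norm_mul, norm_mul, Complex.norm_I, one_mul, Complex.norm_real, Complex.norm_real,
          Real.norm_eq_abs, Real.norm_eq_abs]
        exact mul_le_of_le_one_right (abs_nonneg _) (Real.abs_sin_le_one u)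
    calc _ ≤ (1 + 1 + |z|) * (1 + u ^ 2) := by gcongr
      _ ≤ (3 * (1 + z ^ 2)) * (u ^ 2 + u ^ 2) := by
        gcongr
        nlinarith [sq_nonneg z]
      _ ≤ _ := by nlinarith [mul_nonneg (sq_nonneg z) hu2.le]

/-- Continuity at `0` is essential, since `M` may have an atom there (the Gaussian component of the
limit). -/
lemma continuous_kernel (z : ℝ) : Continuous (kernel z) := by
  rw [continuous_iff_continuousAt]
  intro u₀
  by_cases hu : u₀ = 0
  swap
  · have : kernel z =ᶠ[𝓝 u₀] fun u => (1 - Complex.exp (Complex.I * z * u) +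
        Complex.I * z * (Real.sin u : ℂ)) / (u : ℂ) ^ 2 := by
      filter_upwards [isOpen_ne.mem_nhds hu] with u hu
      exact kernel_of_ne z hu
    refine ContinuousAt.congr ?_ this.symm
    refine ContinuousAt.div (by fun_prop) (by fun_prop) ?_
    exact pow_ne_zero _ (Complex.ofReal_ne_zero.2 hu)
  subst hu
  -- Third-order Taylor remainder of the exponential, plus `|u - sin u| ≤ |u|³`, divided by `u²`.
  have hbound : ∀ᶠ u : ℝ in 𝓝 0, ‖kernel z u - kernel z 0‖ ≤ (|z| ^ 3 + |z|) * |u| := by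
    have h1 : ∀ᶠ u : ℝ in 𝓝 0, |u| ≤ 1 := by
      have : Tendsto (fun u : ℝ => |u|) (𝓝 0) (𝓝 0) := by
        simpa using (continuous_abs.tendsto (0 : ℝ))
      exact (this.eventually (gt_mem_nhds one_pos)).mono fun _ h => le_of_lt h
    have h2 : ∀ᶠ u : ℝ in 𝓝 0, |z * u| ≤ 1 := by
      have : Tendsto (fun u : ℝ => |z * u|) (𝓝 0) (𝓝 0) := by
        have : Continuous fun u : ℝ => |z * u| := by fun_prop
        simpa using this.tendsto 0
      exact (this.eventually (gt_mem_nhds one_pos)).mono fun _ h => le_of_lt h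
    filter_upwards [h1, h2] with u hu1 hzu
    by_cases hu : u = 0
    · subst hu; simp
    have hu' : (u : ℂ) ≠ 0 := Complex.ofReal_ne_zero.2 hu
    have e1 := Complex.exp_bound (x := Complex.I * (z * u : ℝ)) (by
      rw [norm_mul, Complex.norm_I, one_mul, Complex.norm_real, Real.norm_eq_abs]; exact hzu)
      (n := 3) (by norm_num)
    have e2 := abs_sub_sin_le hu1
    have hI : Complex.I ^ 2 = -1 := Complex.I_sq
    have : kernel z u - kernel z 0 =
        (-(Complex.exp (Complex.I * (z * u : ℝ)) -
          ∑ m ∈ Finset.range 3, (Complex.I * (z * u : ℝ)) ^ m / (m.factorial : ℂ)) -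
          Complex.I * (z * (u - Real.sin u) : ℝ)) / (u : ℂ) ^ 2 := by
      rw [kernel_of_ne z hu, kernel_zero, div_sub' (by positivity)]
      congr 1
      simp only [Finset.sum_range_succ, Finset.sum_range_zero, mul_pow, hI]
      push_cast
      simp [Nat.factorial]
      ring_nf
    rw [this, norm_div, norm_pow, Complex.norm_real, Real.norm_eq_abs,
      div_le_iff₀ (by positivity)]
    refine (norm_sub_le _ _).trans ?_
    rw [norm_neg]
    rw [norm_mul, Complex.norm_I, one_mul, Complex.norm_real, Real.norm_eq_abs] at e1
    rw [norm_mul, Complex.norm_I, one_mul, Complex.norm_real, Real.norm_eq_abs, abs_mul]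
    have e3 : |z| * |u - Real.sin u| ≤ |z| * |u| ^ 3 := by gcongr
    have e4 : |z * u| ^ 3 * ((Nat.succ 3 : ℝ) * ((Nat.factorial 3 : ℝ) * (3 : ℕ))⁻¹) ≤
        |z * u| ^ 3 := by
      refine mul_le_of_le_one_right (by positivity) ?_
      norm_num [Nat.factorial]
    rw [abs_mul, mul_pow] at e4
    rw [abs_mul z u, mul_pow] at e1
    calc _ ≤ |z| ^ 3 * |u| ^ 3 + |z| * |u| ^ 3 := add_le_add (e1.trans e4) e3
      _ = _ := by ring
  have : Tendsto (fun u : ℝ => (|z| ^ 3 + |z|) * |u|) (𝓝 0) (𝓝 0) := by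
    have : Continuous fun u : ℝ => (|z| ^ 3 + |z|) * |u| := by fun_prop
    simpa using this.tendsto 0
  exact tendsto_iff_norm_sub_tendsto_zero.2
    (squeeze_zero' (Eventually.of_forall fun _ => norm_nonneg _) hbound this)

lemma kernel_re (z u : ℝ) :
    (kernel z u).re = if u = 0 then z ^ 2 / 2 else (1 - Real.cos (z * u)) / u ^ 2 := by
  split_ifs with hu
  · subst hu
    rw [kernel_zero]
    norm_cast
  · rw [kernel_of_ne z hu]
    have h1 : (1 - Complex.exp (Complex.I * z * u) + Complex.I * z * (Real.sin u : ℂ)) /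
      (u : ℂ) ^ 2 = ((1 - Real.cos (z * u)) / u ^ 2 : ℝ) +
        ((z * Real.sin u - Real.sin (z * u)) / u ^ 2 : ℝ) * Complex.I := by
      have : Complex.I * z * u = ((z * u : ℝ) : ℂ) * Complex.I := by push_cast; ring
      rw [this, Complex.exp_mul_I, ← Complex.ofReal_cos, ← Complex.ofReal_sin]
      push_cast
      ring
    rw [h1, Complex.add_re, Complex.re_ofReal_mul, Complex.I_re, Complex.ofReal_re, mul_zero,
      add_zero]

lemma kernel_re_nonneg (z u : ℝ) : 0 ≤ (kernel z u).re := by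
  rw [kernel_re]
  split_ifs
  · positivity
  · have := Real.cos_le_one (z * u)
    exact div_nonneg (by linarith) (by positivity)

lemma kernel_re_neg (z u : ℝ) : (kernel z (-u)).re = (kernel z u).re := by
  simp [kernel_re]

/-! ### Canonical measures and proper convergence. -/

lemma IsCanonical.isLocallyFiniteMeasure {M : Measure ℝ} (hM : IsCanonical M) :
    IsLocallyFiniteMeasure M :=
  ⟨fun x => ⟨Set.Icc (x - 1) (x + 1), Icc_mem_nhds (by linarith) (by linarith),
    hM.finite_Icc _ _⟩⟩

lemma IsCanonical.measure_Ioc_lt_top {M : Measure ℝ} (hM : IsCanonical M) (x y : ℝ) :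
    M (Set.Ioc x y) < ⊤ :=
  (measure_mono Set.Ioc_subset_Icc_self).trans_lt (hM.finite_Icc x y)

lemma integrable_inv_one_add_sq_of_isCanonical {M : Measure ℝ} (hM : IsCanonical M) :
    Integrable (fun u : ℝ => (1 + u ^ 2)⁻¹) M := by
  have hc : Continuous fun u : ℝ => (1 + u ^ 2)⁻¹ :=
    Continuous.inv₀ (by fun_prop) fun u => by positivity
  refine ⟨hc.aestronglyMeasurable, ?_⟩
  rw [hasFiniteIntegral_iff_ofReal (ae_of_all _ fun u => by positivity)]
  have huniv : (Set.univ : Set ℝ) = Set.Iio (-1) ∪ Set.Icc (-1) 1 ∪ Set.Ioi 1 := by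
    ext u
    simp only [Set.mem_univ, Set.mem_union, Set.mem_Iio, Set.mem_Icc, Set.mem_Ioi, true_iff]
    rcases lt_or_ge u (-1) with h | h
    · exact Or.inl (Or.inl h)
    · rcases le_or_gt u 1 with h' | h'
      · exact Or.inl (Or.inr ⟨h, h'⟩)
      · exact Or.inr h'
  have hle : ∀ u : ℝ, u ≠ 0 → ENNReal.ofReal ((1 + u ^ 2)⁻¹) ≤ ENNReal.ofReal (1 / u ^ 2) := by
    intro u hu
    have : 0 < u ^ 2 := by positivity
    rw [one_div]
    gcongr
    linarith
  rw [← setLIntegral_univ, huniv]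
  refine (lintegral_union_le _ _ _).trans_lt (ENNReal.add_lt_top.2
    ⟨(lintegral_union_le _ _ _).trans_lt (ENNReal.add_lt_top.2 ⟨?_, ?_⟩), ?_⟩)
  · refine (setLIntegral_mono' measurableSet_Iio fun u hu => hle u ?_).trans_lt
      (hM.finite_left 1 one_pos)
    rintro rfl; simp at hu; linarith
  · refine (setLIntegral_mono' measurableSet_Icc (g := fun _ => 1) fun u hu => ?_).trans_lt ?_
    · rw [ENNReal.ofReal_le_one]
      exact inv_le_one_of_one_le₀ (by nlinarith [sq_nonneg u])
    · simpa using hM.finite_Icc (-1) 1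
  · refine (setLIntegral_mono' measurableSet_Ioi fun u hu => hle u ?_).trans_lt
      (hM.finite_right 1 one_pos)
    rintro rfl; simp at hu; linarith

lemma integrable_of_norm_le {M : Measure ℝ} (hM : IsCanonical M) {f : ℝ → ℂ} (hf : Continuous f)
    {K : ℝ} (hK : ∀ u, ‖f u‖ ≤ K * (1 + u ^ 2)⁻¹) : Integrable f M :=
  ((integrable_inv_one_add_sq_of_isCanonical hM).const_mul K).mono' hf.aestronglyMeasurable
    (ae_of_all _ hK)

lemma integrable_kernel {M : Measure ℝ} (hM : IsCanonical M) (z : ℝ) :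
    Integrable (kernel z) M :=
  integrable_of_norm_le hM (continuous_kernel z) (norm_kernel_le z)

lemma norm_phi_le {M : Measure ℝ} (hM : IsCanonical M) (z : ℝ) :
    ‖phi M z‖ ≤ 8 * (∫ u, (1 + u ^ 2)⁻¹ ∂M) * (1 + z ^ 2) := by
  refine (norm_integral_le_of_norm_le ((integrable_inv_one_add_sq_of_isCanonical hM).const_mul _)
    (ae_of_all _ (norm_kernel_le z))).trans_eq ?_
  rw [integral_const_mul]
  ring

lemma phi_re {M : Measure ℝ} (hM : IsCanonical M) (z : ℝ) :
    (phi M z).re = ∫ u, (kernel z u).re ∂M :=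
  (Complex.reCLM.integral_comp_comm (integrable_kernel hM z)).symm

lemma continuous_phi {M : Measure ℝ} (hM : IsCanonical M) : Continuous (phi M) := by
  rw [continuous_iff_continuousAt]
  intro z₀
  refine continuousAt_of_dominated (F := kernel)
    (bound := fun u => 8 * (1 + (|z₀| + 1) ^ 2) * (1 + u ^ 2)⁻¹)
    (Eventually.of_forall fun z => (continuous_kernel z).aestronglyMeasurable) ?_
    ((integrable_inv_one_add_sq_of_isCanonical hM).const_mul _)
    (ae_of_all _ fun u => (continuous_kernel_left u).continuousAt)
  filter_upwards [eventually_abs_sub_lt z₀ one_pos] with z hz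
  refine ae_of_all _ fun u => (norm_kernel_le z u).trans ?_
  gcongr 8 * (1 + ?_) * _
  rw [← sq_abs z]
  gcongr
  have := abs_sub_abs_le_abs_sub z z₀
  linarith

/-- Continuity from above of the measure with density `f`. -/
lemma tendsto_setLIntegral_of_antitone {M : Measure ℝ} {f : ℝ → ℝ≥0∞} {s : ℕ → Set ℝ}
    (hs : ∀ k, MeasurableSet (s k)) (hanti : Antitone s) (hempty : ⋂ k, s k = ∅)
    (hfin : ∫⁻ u in s 0, f u ∂M < ⊤) :
    Tendsto (fun k => ∫⁻ u in s k, f u ∂M) atTop (𝓝 0) := by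
  have h := tendsto_measure_iInter_atTop (μ := M.withDensity f) (s := s)
    (fun k => (hs k).nullMeasurableSet) hanti ⟨0, by
      rw [withDensity_apply _ (hs 0)]; exact hfin.ne⟩
  rw [hempty, measure_empty] at h
  refine h.congr fun k => ?_
  rw [Function.comp, withDensity_apply _ (hs k)]

lemma IsCanonical.exists_tail_le {M : Measure ℝ} (hM : IsCanonical M) {ε : ℝ} (hε : 0 < ε) :
    ∃ T : ℝ, 1 ≤ T ∧ ∫⁻ u in Set.Ioi T, ENNReal.ofReal (1 / u ^ 2) ∂M ≤ ENNReal.ofReal ε ∧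
      ∫⁻ u in Set.Iio (-T), ENNReal.ofReal (1 / u ^ 2) ∂M ≤ ENNReal.ofReal ε := by
  have h1 := tendsto_setLIntegral_of_antitone (M := M) (f := fun u => ENNReal.ofReal (1 / u ^ 2))
    (s := fun k : ℕ => Set.Ioi ((k : ℝ) + 1)) (fun _ => measurableSet_Ioi)
    (fun i j hij => Set.Ioi_subset_Ioi (by
      have : (i : ℝ) ≤ j := by exact_mod_cast hij
      linarith)) (by
      refine Set.eq_empty_of_forall_notMem fun u hu => ?_
      obtain ⟨k, hk⟩ := exists_nat_gt u
      have := Set.mem_iInter.1 hu k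
      simp only [Set.mem_Ioi] at this
      linarith) (by simpa using hM.finite_right 1 one_pos)
  have h2 := tendsto_setLIntegral_of_antitone (M := M) (f := fun u => ENNReal.ofReal (1 / u ^ 2))
    (s := fun k : ℕ => Set.Iio (-((k : ℝ) + 1))) (fun _ => measurableSet_Iio)
    (fun i j hij => Set.Iio_subset_Iio (by
      have : (i : ℝ) ≤ j := by exact_mod_cast hij
      linarith)) (by
      refine Set.eq_empty_of_forall_notMem fun u hu => ?_
      obtain ⟨k, hk⟩ := exists_nat_gt (-u)
      have := Set.mem_iInter.1 hu k
      simp only [Set.mem_Iio] at this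
      linarith) (by simpa using hM.finite_left 1 one_pos)
  have hε' : (0 : ℝ≥0∞) < ENNReal.ofReal ε := ENNReal.ofReal_pos.2 hε
  obtain ⟨k, hk1, hk2⟩ := ((h1.eventually (gt_mem_nhds hε')).and
    (h2.eventually (gt_mem_nhds hε'))).exists
  exact ⟨k + 1, by linarith [(Nat.cast_nonneg k : (0 : ℝ) ≤ k)], hk1.le, hk2.le⟩

/-- Comparison of an integral over `(c 0, c N]` with a step-function approximation. -/
lemma norm_setIntegral_sub_sum_le {μ : Measure ℝ} (hμ : ∀ x y, μ (Set.Ioc x y) < ⊤) {f : ℝ → ℂ}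
    (hf : Integrable f μ) {c : ℕ → ℝ} (hc : Monotone c) {η : ℝ} (N : ℕ)
    (h : ∀ i < N, ∀ u ∈ Set.Ioc (c i) (c (i + 1)), ‖f u - f (c (i + 1))‖ ≤ η) :
    ‖∫ u in Set.Ioc (c 0) (c N), f u ∂μ -
        ∑ i ∈ Finset.range N, μ.real (Set.Ioc (c i) (c (i + 1))) • f (c (i + 1))‖ ≤
      η * μ.real (Set.Ioc (c 0) (c N)) := by
  induction N with
  | zero => simp
  | succ N ih =>
    have hdisj : Disjoint (Set.Ioc (c 0) (c N)) (Set.Ioc (c N) (c (N + 1))) :=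
      Set.Ioc_disjoint_Ioc_of_le le_rfl
    have hun : Set.Ioc (c 0) (c (N + 1)) = Set.Ioc (c 0) (c N) ∪ Set.Ioc (c N) (c (N + 1)) :=
      (Set.Ioc_union_Ioc_eq_Ioc (hc (Nat.zero_le N)) (hc (Nat.le_succ N))).symm
    rw [hun, setIntegral_union hdisj measurableSet_Ioc hf.integrableOn hf.integrableOn,
      measureReal_union hdisj measurableSet_Ioc (hμ _ _).ne (hμ _ _).ne, Finset.sum_range_succ,
      add_sub_add_comm, mul_add]
    refine (norm_add_le _ _).trans (add_le_add (ih fun i hi => h i (by omega)) ?_)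
    rw [← setIntegral_const, ← integral_sub hf.integrableOn
      (integrableOn_const (hμ _ _).ne (by simp))]
    exact norm_setIntegral_le_of_norm_le_const (hμ _ _) (fun u hu => h N (by omega) u hu)

/-- The complement of `(x, y]` contains the endpoint `x`, whereas the left tail functional uses open
half-lines; the extra point `w > x` absorbs it. -/
lemma norm_integral_sub_setIntegral_le {μ : Measure ℝ} (hμ : IsCanonical μ) {f : ℝ → ℂ}
    (hf : Continuous f) {K : ℝ} (hK0 : 0 ≤ K) (hK : ∀ u, ‖f u‖ ≤ K * (1 + u ^ 2)⁻¹)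
    {x y w : ℝ} (hxw : x < w) (hw : w < 0) (hy : 0 < y) :
    ‖∫ u, f u ∂μ - ∫ u in Set.Ioc x y, f u ∂μ‖ ≤
      K * ((∫⁻ u in Set.Iio w, ENNReal.ofReal (1 / u ^ 2) ∂μ).toReal +
        (∫⁻ u in Set.Ioi y, ENNReal.ofReal (1 / u ^ 2) ∂μ).toReal) := by
  have hfi := integrable_of_norm_le hμ hf hK
  have hcompl : (Set.Ioc x y)ᶜ ⊆ Set.Iio w ∪ Set.Ioi y := by
    intro u hu
    simp only [Set.mem_compl_iff, Set.mem_Ioc, not_and_or, not_lt, not_le] at hu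
    rcases hu with h | h
    · exact Or.inl (lt_of_le_of_lt h hxw)
    · exact Or.inr h
  have h1 : ∫ u, f u ∂μ - ∫ u in Set.Ioc x y, f u ∂μ = ∫ u in (Set.Ioc x y)ᶜ, f u ∂μ := by
    rw [← integral_add_compl (measurableSet_Ioc (a := x) (b := y)) hfi]; ring
  have hL : ∫⁻ u in Set.Iio w, ENNReal.ofReal (1 / u ^ 2) ∂μ < ⊤ := by
    simpa using hμ.finite_left (-w) (by linarith)
  have hR := hμ.finite_right y hy
  rw [h1]
  refine (norm_integral_le_lintegral_norm _).trans ?_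
  rw [← ENNReal.toReal_add hL.ne hR.ne, ← ENNReal.toReal_ofReal hK0, ← ENNReal.toReal_mul]
  refine ENNReal.toReal_mono (ENNReal.mul_ne_top ENNReal.ofReal_ne_top
    (ENNReal.add_ne_top.2 ⟨hL.ne, hR.ne⟩)) ?_
  refine (lintegral_mono_set hcompl).trans ((lintegral_union_le _ _ _).trans ?_)
  have hb : ∀ u : ℝ, u ≠ 0 →
      ENNReal.ofReal ‖f u‖ ≤ ENNReal.ofReal K * ENNReal.ofReal (1 / u ^ 2) := by
    intro u hu
    rw [← ENNReal.ofReal_mul hK0]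
    refine ENNReal.ofReal_le_ofReal ((hK u).trans ?_)
    have : 0 < u ^ 2 := by positivity
    rw [one_div]
    gcongr
    linarith
  have hm : Measurable fun u : ℝ => ENNReal.ofReal (1 / u ^ 2) := by fun_prop
  rw [mul_add, ← lintegral_const_mul _ hm, ← lintegral_const_mul _ hm]
  refine add_le_add (setLIntegral_mono' measurableSet_Iio fun u hu => hb u ?_)
    (setLIntegral_mono' measurableSet_Ioi fun u hu => hb u ?_)
  · exact (lt_trans hu hw).ne
  · exact (lt_trans hy hu).ne'

/-- Proper convergence implies convergence of integrals of continuous functions that are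
`O(1 / (1 + u²))`. -/
theorem TendstoProperly.tendsto_integral {Mn : ℕ → Measure ℝ} {M : Measure ℝ}
    (h : TendstoProperly Mn M) (hMn : ∀ n, IsCanonical (Mn n)) (hM : IsCanonical M) {f : ℝ → ℂ}
    (hf : Continuous f) {K : ℝ} (hK : ∀ u, ‖f u‖ ≤ K * (1 + u ^ 2)⁻¹) :
    Tendsto (fun n => ∫ u, f u ∂(Mn n)) atTop (𝓝 (∫ u, f u ∂M)) := by
  have hK0 : 0 ≤ K := by simpa using (norm_nonneg _).trans (hK 0)
  rw [Metric.tendsto_atTop']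
  intro ε' hε'
  -- The final triangle inequality costs less than `4 K ε + 4 ε`.
  obtain ⟨ε, hε, hεε⟩ : ∃ ε : ℝ, 0 < ε ∧ 4 * K * ε + 5 * ε < ε' := by
    refine ⟨ε' / (4 * K + 6), by positivity, ?_⟩
    rw [← add_mul, mul_div_assoc', div_lt_iff₀ (by positivity)]
    nlinarith
  have := hM.isLocallyFiniteMeasure
  obtain ⟨T, hT1, hTR, hTL⟩ := hM.exists_tail_le hε
  set m := M.real (Set.Icc (-T - 2) (T + 2)) with hm
  have hm0 : 0 ≤ m := measureReal_nonneg
  have hunif := isCompact_Icc.uniformContinuousOn_of_continuous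
    (hf.continuousOn (s := Set.Icc (-T - 2) (T + 2)))
  obtain ⟨d, hd, hfd⟩ := Metric.uniformContinuousOn_iff_le.1 hunif (ε / (m + 1)) (by positivity)
  -- a partition by points that are not atoms
  have hatoms : {x : ℝ | 0 < M {x}}.Countable :=
    Measure.countable_meas_pos_of_disjoint_iUnion (μ := M) (As := fun x : ℝ => {x})
      (fun x => measurableSet_singleton x) (fun x y hxy => by simpa using hxy)
  have hdense := hatoms.dense_compl ℝ
  -- One non-atom is chosen in each grid cell, so consecutive points are less than `2 * step ≤ d`
  -- apart; cells of length at most `1 / 2` also place both `c 0` and `c 1` to the left of `-T`.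
  obtain ⟨step, hstep, hstep1, hstepd⟩ : ∃ s : ℝ, 0 < s ∧ s ≤ 1 / 2 ∧ 2 * s ≤ d :=
    ⟨min (1 / 2) (d / 2), by positivity, min_le_left _ _, by linarith [min_le_right (1 / 2) (d / 2)]⟩
  have hex : ∀ i : ℕ, ∃ x : ℝ, -T - 1 + step * i < x ∧ x < -T - 1 + step * (i + 1) ∧
      M {x} = 0 := by
    intro i
    obtain ⟨x, hx, hx'⟩ := hdense.exists_between
      (show -T - 1 + step * i < -T - 1 + step * (i + 1) by linarith)
    exact ⟨x, hx'.1, hx'.2, by simpa using hx⟩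
  choose c hc1 hc2 hc0 using hex
  have hcs : ∀ i, c i < c (i + 1) := fun i => (hc2 i).trans (by simpa using hc1 (i + 1))
  have hcm : StrictMono c := strictMono_nat_of_lt_succ hcs
  obtain ⟨N, hN1, hN2⟩ : ∃ N : ℕ, 2 * T + 1 ≤ step * N ∧ step * N ≤ 2 * T + 1 + step := by
    refine ⟨⌈(2 * T + 1) / step⌉₊, ?_, ?_⟩
    · rw [mul_comm step, ← div_le_iff₀ hstep]; exact Nat.le_ceil _
    · have := (Nat.ceil_lt_add_one (show 0 ≤ (2 * T + 1) / step by positivity)).le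
      calc step * _ ≤ step * ((2 * T + 1) / step + 1) := by gcongr
        _ = _ := by field_simp
  have hN0 : 0 < N := by
    rcases Nat.eq_zero_or_pos N with h0 | h0
    · subst h0; simp at hN1; linarith
    · exact h0
  have hcN : T < c N := by linarith [hc1 N]
  have hcN' : c N < T + 2 := by linarith [hc2 N]
  have hc0' : -T - 2 < c 0 := by have := hc1 0; simp at this; linarith
  have hc1T : c 1 < -T := by have := hc2 1; norm_num at this; linarith
  have hmem : ∀ i ≤ N, c i ∈ Set.Icc (-T - 2) (T + 2) := fun i hi =>
    ⟨hc0'.le.trans (hcm.monotone (Nat.zero_le i)), (hcm.monotone hi).trans hcN'.le⟩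
  have hosc : ∀ i < N, ∀ u ∈ Set.Ioc (c i) (c (i + 1)),
      ‖f u - f (c (i + 1))‖ ≤ ε / (m + 1) := by
    intro i hi u hu
    rw [← dist_eq_norm]
    refine hfd u ⟨(hmem i hi.le).1.trans hu.1.le, hu.2.trans (hmem (i + 1) hi).2⟩ _
      (hmem (i + 1) hi) ?_
    rw [Real.dist_eq, abs_sub_comm, abs_of_nonneg (by linarith [hu.2])]
    have h1 := hc1 i
    have h2 := hc2 (i + 1)
    push_cast at h2
    linarith [hu.1]
  set S : Measure ℝ → ℂ := fun μ =>
    ∑ i ∈ Finset.range N, μ.real (Set.Ioc (c i) (c (i + 1))) • f (c (i + 1)) with hS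
  -- The error bound is built from quantities that converge along `Mn`, so it only has to be small
  -- for the limit `M`.
  set E : Measure ℝ → ℝ := fun μ =>
    K * ((∫⁻ u in Set.Iio (c 1), ENNReal.ofReal (1 / u ^ 2) ∂μ).toReal +
      (∫⁻ u in Set.Ioi (c N), ENNReal.ofReal (1 / u ^ 2) ∂μ).toReal) +
      ε / (m + 1) * μ.real (Set.Ioc (c 0) (c N)) with hE
  have hbound : ∀ μ, IsCanonical μ → ‖∫ u, f u ∂μ - S μ‖ ≤ E μ := by
    intro μ hμ
    have h1 := norm_integral_sub_setIntegral_le hμ hf hK0 hK (hcs 0) (by simp; linarith)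
      (show 0 < c N by linarith)
    have h2 := norm_setIntegral_sub_sum_le hμ.measure_Ioc_lt_top (integrable_of_norm_le hμ hf hK)
      hcm.monotone N hosc
    calc _ = ‖(∫ u, f u ∂μ - ∫ u in Set.Ioc (c 0) (c N), f u ∂μ) +
          (∫ u in Set.Ioc (c 0) (c N), f u ∂μ - S μ)‖ := by rw [sub_add_sub_cancel]
      _ ≤ _ := (norm_add_le _ _).trans (add_le_add h1 h2)
  have hIoc : ∀ i j, i < j → Tendsto (fun n => (Mn n).real (Set.Ioc (c i) (c j))) atTop
      (𝓝 (M.real (Set.Ioc (c i) (c j)))) := fun i j hij =>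
    (ENNReal.tendsto_toReal (hM.measure_Ioc_lt_top _ _).ne).comp
      (h.interval _ _ (hcm hij) (hc0 i) (hc0 j))
  have hSt : Tendsto (fun n => S (Mn n)) atTop (𝓝 (S M)) :=
    tendsto_finsetSum _ fun i _ => (hIoc i (i + 1) (Nat.lt_succ_self i)).smul_const _
  have hLfin : ∫⁻ u in Set.Iio (c 1), ENNReal.ofReal (1 / u ^ 2) ∂M < ⊤ := by
    simpa using hM.finite_left (-c 1) (by linarith)
  have hRfin := hM.finite_right (c N) (by linarith)
  have hLt : Tendsto (fun n => (∫⁻ u in Set.Iio (c 1), ENNReal.ofReal (1 / u ^ 2) ∂(Mn n)).toReal)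
      atTop (𝓝 (∫⁻ u in Set.Iio (c 1), ENNReal.ofReal (1 / u ^ 2) ∂M).toReal) := by
    have := h.left (-c 1) (by linarith) (by simpa using hc0 1)
    rw [neg_neg] at this
    exact (ENNReal.tendsto_toReal hLfin.ne).comp this
  have hRt : Tendsto (fun n => (∫⁻ u in Set.Ioi (c N), ENNReal.ofReal (1 / u ^ 2) ∂(Mn n)).toReal)
      atTop (𝓝 (∫⁻ u in Set.Ioi (c N), ENNReal.ofReal (1 / u ^ 2) ∂M).toReal) :=
    (ENNReal.tendsto_toReal hRfin.ne).comp (h.right _ (by linarith) (hc0 N))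
  have hEt : Tendsto (fun n => E (Mn n)) atTop (𝓝 (E M)) :=
    ((hLt.add hRt).const_mul K).add ((hIoc 0 N hN0).const_mul _)
  have hEM : E M ≤ 2 * K * ε + ε := by
    have h1 : (∫⁻ u in Set.Iio (c 1), ENNReal.ofReal (1 / u ^ 2) ∂M).toReal ≤ ε :=
      ENNReal.toReal_le_of_le_ofReal hε.le
        ((lintegral_mono_set (Set.Iio_subset_Iio hc1T.le)).trans hTL)
    have h2 : (∫⁻ u in Set.Ioi (c N), ENNReal.ofReal (1 / u ^ 2) ∂M).toReal ≤ ε :=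
      ENNReal.toReal_le_of_le_ofReal hε.le
        ((lintegral_mono_set (Set.Ioi_subset_Ioi hcN.le)).trans hTR)
    have h3 : M.real (Set.Ioc (c 0) (c N)) ≤ m :=
      measureReal_mono (Set.Ioc_subset_Icc_self.trans (Set.Icc_subset_Icc hc0'.le hcN'.le))
        (hM.finite_Icc _ _).ne
    have h4 : ε / (m + 1) * M.real (Set.Ioc (c 0) (c N)) ≤ ε := by
      rw [div_mul_eq_mul_div, div_le_iff₀ (by positivity)]
      gcongr
      linarith
    calc E M ≤ K * (ε + ε) + ε := by
          simp only [hE]; gcongr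
      _ = _ := by ring
  have hev1 := hEt.eventually (gt_mem_nhds (show E M < E M + ε by linarith))
  have hev2 := Metric.tendsto_nhds.1 hSt ε hε
  obtain ⟨n0, hn0⟩ := eventually_atTop.1 (hev1.and hev2)
  refine ⟨n0, fun n hn => ?_⟩
  obtain ⟨h1, h2⟩ := hn0 n hn.le
  have b1 := hbound _ (hMn n)
  have b2 := hbound _ hM
  rw [← dist_eq_norm] at b1 b2
  rw [dist_comm] at b2
  have t1 := dist_triangle4 (∫ u, f u ∂(Mn n)) (S (Mn n)) (S M) (∫ u, f u ∂M)
  linarith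

/-! ### Exponents of the rows of the array. -/

lemma setLIntegral_arrayMeasure (k : ℕ) (F : Measure ℝ) {h : ℝ → ℝ≥0∞} (hh : Measurable h)
    {s : Set ℝ} (hs : MeasurableSet s) :
    ∫⁻ u in s, h u ∂(arrayMeasure k F) =
      ∫⁻ u in s, (k : ℝ≥0∞) * ENNReal.ofReal (u ^ 2) * h u ∂F := by
  rw [arrayMeasure, setLIntegral_withDensity_eq_setLIntegral_mul _ (by fun_prop) hh hs]
  rfl

lemma isCanonical_arrayMeasure (k : ℕ) (F : Measure ℝ) [IsProbabilityMeasure F] :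
    IsCanonical (arrayMeasure k F) := by
  have htail : ∀ s : Set ℝ, MeasurableSet s →
      ∫⁻ u in s, ENNReal.ofReal (1 / u ^ 2) ∂(arrayMeasure k F) < ⊤ := by
    intro s hs
    rw [setLIntegral_arrayMeasure k F (by fun_prop) hs]
    refine (lintegral_mono (g := fun _ => (k : ℝ≥0∞)) fun u => ?_).trans_lt ?_
    · rw [mul_assoc, ← ENNReal.ofReal_mul (by positivity)]
      refine mul_le_of_le_one_right (by positivity) ?_
      rw [ENNReal.ofReal_le_one, mul_one_div]
      exact div_self_le_one _
    · rw [lintegral_const]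
      exact ENNReal.mul_lt_top (by simp) (measure_lt_top _ _)
  refine ⟨fun x y => ?_, fun x _ => htail _ measurableSet_Ioi, fun x _ => htail _ measurableSet_Iio⟩
  rw [arrayMeasure, withDensity_apply _ measurableSet_Icc]
  refine (setLIntegral_mono' (g := fun _ => (k : ℝ≥0∞) * ENNReal.ofReal (x ^ 2 + y ^ 2))
    measurableSet_Icc fun u hu => ?_).trans_lt ?_
  · gcongr
    rcases le_total 0 u with h | h
    · nlinarith [hu.2, sq_nonneg x]
    · nlinarith [hu.1, sq_nonneg y]
  · rw [lintegral_const]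
    exact ENNReal.mul_lt_top (ENNReal.mul_lt_top (by simp) ENNReal.ofReal_lt_top)
      (measure_lt_top _ _)

lemma integrable_cexp_charFun (F : Measure ℝ) [IsProbabilityMeasure F] (z : ℝ) :
    Integrable (fun u : ℝ => Complex.exp (Complex.I * z * u)) F :=
  Integrable.of_bound (by fun_prop) 1 (ae_of_all _ fun u => (norm_cexp_I_mul z u).le)

/-- The density `k u²` cancels the denominator of the kernel, and the atom of `F` at `0` contributes
nothing to either side. -/
lemma phi_arrayMeasure (k : ℕ) (F : Measure ℝ) [IsProbabilityMeasure F] (z : ℝ) :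
    phi (arrayMeasure k F) z = k * (1 - charFun F z) + Complex.I * z * ((k * sinMean F : ℝ) : ℂ) := by
  have h0 : Integrable (fun _ : ℝ => (1 : ℂ)) F := integrable_const _
  have h1 := integrable_cexp_charFun F z
  have h2 : Integrable (fun u : ℝ => Complex.I * z * (Real.sin u : ℂ)) F := by
    refine (Integrable.of_bound (by fun_prop) 1 (ae_of_all _ fun u => ?_)).const_mul _
    rw [Complex.norm_real]
    exact Real.abs_sin_le_one u
  have h3 : phi (arrayMeasure k F) z = ∫ u : ℝ, (k : ℂ) * (1 - Complex.exp (Complex.I * z * u) +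
      Complex.I * z * (Real.sin u : ℂ)) ∂F := by
    rw [phi, arrayMeasure, integral_withDensity_eq_integral_toReal_smul (by fun_prop)
      (ae_of_all _ fun u => ENNReal.mul_lt_top (by simp) ENNReal.ofReal_lt_top)]
    congr 1
    ext u
    rw [ENNReal.toReal_mul, ENNReal.toReal_natCast, ENNReal.toReal_ofReal (sq_nonneg u),
      Complex.real_smul]
    by_cases hu : u = 0
    · subst hu; simp
    · have : (u : ℂ) ≠ 0 := Complex.ofReal_ne_zero.2 hu
      rw [kernel_of_ne z hu]
      push_cast
      field_simp
  have h01 : Integrable (fun u : ℝ => 1 - Complex.exp (Complex.I * z * u)) F := h0.sub h1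
  rw [h3, integral_const_mul, integral_add h01 h2, integral_sub h0 h1, integral_const_mul,
    integral_complex_ofReal, charFun_apply_real]
  simp only [integral_const, probReal_univ, one_smul, sinMean]
  push_cast
  have : ∀ u : ℝ, Complex.I * z * u = z * u * Complex.I := fun u => by ring
  simp_rw [this]
  ring

/-- With its own centring, the exponent of a row is that of the accompanying compound Poisson law.
-/
lemma psi_arrayMeasure (k : ℕ) (F : Measure ℝ) [IsProbabilityMeasure F] (z : ℝ) :
    psi (arrayMeasure k F) (k * sinMean F) z = k * (1 - charFun F z) := by
  rw [psi, phi_arrayMeasure]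
  ring

lemma psi_re (M : Measure ℝ) (β z : ℝ) : (psi M β z).re = (phi M z).re := by
  have : -Complex.I * β * z = ((-(β * z) : ℝ) : ℂ) * Complex.I := by push_cast; ring
  rw [psi, this, Complex.add_re, Complex.re_ofReal_mul]
  simp

lemma phi_re_nonneg {M : Measure ℝ} (hM : IsCanonical M) (z : ℝ) : 0 ≤ (phi M z).re := by
  rw [phi_re hM]
  exact integral_nonneg fun u => kernel_re_nonneg z u

lemma charFun_re (G : Measure ℝ) [IsProbabilityMeasure G] (y : ℝ) :
    (charFun G y).re = ∫ x, Real.cos (y * x) ∂G := by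
  have h := integrable_cexp_charFun G y
  have h1 : charFun G y = ∫ x : ℝ, Complex.exp (Complex.I * y * x) ∂G := by
    rw [charFun_apply_real]; congr 1; ext x; ring_nf
  rw [h1]
  refine (Complex.reCLM.integral_comp_comm h).symm.trans ?_
  congr 1
  ext x
  have : Complex.I * y * x = ((y * x : ℝ) : ℂ) * Complex.I := by push_cast; ring
  rw [this, Complex.reCLM_apply, Complex.exp_ofReal_mul_I_re]

lemma charFun_im (G : Measure ℝ) [IsProbabilityMeasure G] (y : ℝ) :
    (charFun G y).im = ∫ x, Real.sin (y * x) ∂G := by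
  have h := integrable_cexp_charFun G y
  have h1 : charFun G y = ∫ x : ℝ, Complex.exp (Complex.I * y * x) ∂G := by
    rw [charFun_apply_real]; congr 1; ext x; ring_nf
  rw [h1]
  refine (Complex.imCLM.integral_comp_comm h).symm.trans ?_
  congr 1
  ext x
  have : Complex.I * y * x = ((y * x : ℝ) : ℂ) * Complex.I := by push_cast; ring
  rw [this, Complex.imCLM_apply, Complex.exp_ofReal_mul_I_im]

lemma integrable_cos_comp {X : Type*} [MeasurableSpace X] {μ : Measure X} [IsFiniteMeasure μ]
    {h : X → ℝ} (hh : Measurable h) : Integrable (fun x => Real.cos (h x)) μ :=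
  Integrable.of_bound (by fun_prop) 1 (ae_of_all _ fun x => Real.abs_cos_le_one _)

lemma integrable_sin_comp {X : Type*} [MeasurableSpace X] {μ : Measure X} [IsFiniteMeasure μ]
    {h : X → ℝ} (hh : Measurable h) : Integrable (fun x => Real.sin (h x)) μ :=
  Integrable.of_bound (by fun_prop) 1 (ae_of_all _ fun x => Real.abs_sin_le_one _)

lemma lintegral_symm_of_even (m : Measure ℝ) {h : ℝ → ℝ≥0∞} (hh : Measurable h)
    (heven : ∀ u, h (-u) = h u) : ∫⁻ u, h u ∂(symm m) = ∫⁻ u, h u ∂m := by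
  rw [symm, lintegral_smul_measure, lintegral_add_measure, lintegral_map hh (by fun_prop)]
  simp_rw [heven]
  rw [smul_eq_mul, ← two_mul, ← mul_assoc, ENNReal.inv_mul_cancel (by simp) (by simp), one_mul]

/-- Reads alternative (a) of condition F as a lower bound for the real part of the row exponent. -/
lemma integral_one_sub_cos_symm (F : Measure ℝ) [IsProbabilityMeasure F] (z : ℝ) :
    ∫ u, (1 - Real.cos (z * u)) ∂(symm F) = 1 - (charFun F z).re := by
  have hnn : ∀ u, 0 ≤ 1 - Real.cos (z * u) := fun u => by linarith [Real.cos_le_one (z * u)]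
  have h1 : ∫ u, (1 - Real.cos (z * u)) ∂F = 1 - (charFun F z).re := by
    rw [integral_sub (integrable_const _) (integrable_cos_comp (by fun_prop)), charFun_re]
    simp
  rw [← h1, integral_eq_lintegral_of_nonneg_ae (ae_of_all _ hnn) (by fun_prop),
    integral_eq_lintegral_of_nonneg_ae (ae_of_all _ hnn) (by fun_prop),
    lintegral_symm_of_even _ (by fun_prop)]
  intro u
  rw [mul_neg, Real.cos_neg]

/-- The real part of the kernel is even and nonnegative, so `Re φ` is a monotone function of the
symmetrized measure. This serves alternative (b) of condition F. -/
lemma phi_re_le_of_symm_le {M M' : Measure ℝ} (hM : IsCanonical M) (hM' : IsCanonical M')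
    (h : symm M ≤ symm M') (z : ℝ) : (phi M z).re ≤ (phi M' z).re := by
  have hc : Continuous fun u => (kernel z u).re := Complex.continuous_re.comp (continuous_kernel z)
  have hm : Measurable fun u => ENNReal.ofReal (kernel z u).re := hc.measurable.ennreal_ofReal
  have heven : ∀ u, ENNReal.ofReal (kernel z (-u)).re = ENNReal.ofReal (kernel z u).re := fun u => by
    rw [kernel_re_neg]
  have key : ∀ m, IsCanonical m →
      ENNReal.ofReal (phi m z).re = ∫⁻ u, ENNReal.ofReal (kernel z u).re ∂(symm m) := by
    intro m hm'
    rw [lintegral_symm_of_even _ hm heven, phi_re hm']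
    exact ofReal_integral_eq_lintegral_ofReal (integrable_kernel hm' z).re
      (ae_of_all _ (kernel_re_nonneg z))
  rw [← ENNReal.ofReal_le_ofReal_iff (phi_re_nonneg hM' z), key M hM, key M' hM']
  exact lintegral_mono' h le_rfl

/-! ### Characteristic functions with real part bounded away from zero -/

/-- `|θ|²` is the characteristic function of the difference of two independent copies. -/
lemma normSq_charFun_eq (G : Measure ℝ) [IsProbabilityMeasure G] (y : ℝ) :
    ‖charFun G y‖ ^ 2 = ∫ p : ℝ × ℝ, Real.cos (y * (p.1 - p.2)) ∂(G.prod G) := by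
  have hc : Integrable (fun p : ℝ × ℝ => Real.cos (y * p.1) * Real.cos (y * p.2)) (G.prod G) :=
    (integrable_cos_comp (by fun_prop)).mul_prod (integrable_cos_comp (by fun_prop))
  have hs : Integrable (fun p : ℝ × ℝ => Real.sin (y * p.1) * Real.sin (y * p.2)) (G.prod G) :=
    (integrable_sin_comp (by fun_prop)).mul_prod (integrable_sin_comp (by fun_prop))
  rw [← Complex.normSq_eq_norm_sq, Complex.normSq_apply, charFun_re, charFun_im,
    ← integral_prod_mul, ← integral_prod_mul, ← integral_add hc hs]
  congr 1
  ext p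
  rw [mul_sub, Real.cos_sub]

lemma one_sub_normSq_charFun_eq (G : Measure ℝ) [IsProbabilityMeasure G] (y : ℝ) :
    1 - ‖charFun G y‖ ^ 2 = ∫ p : ℝ × ℝ, (1 - Real.cos (y * (p.1 - p.2))) ∂(G.prod G) := by
  rw [integral_sub (integrable_const _) (integrable_cos_comp (by fun_prop)), normSq_charFun_eq]
  simp

/-- Integrate `1 - cos 2t ≤ 4 (1 - cos t)`. -/
lemma one_sub_normSq_charFun_two_mul_le (G : Measure ℝ) [IsProbabilityMeasure G] (y : ℝ) :
    1 - ‖charFun G (2 * y)‖ ^ 2 ≤ 4 * (1 - ‖charFun G y‖ ^ 2) := by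
  rw [one_sub_normSq_charFun_eq, one_sub_normSq_charFun_eq, ← integral_const_mul]
  refine integral_mono ((integrable_const _).sub (integrable_cos_comp (by fun_prop)))
    (((integrable_const _).sub (integrable_cos_comp (by fun_prop))).const_mul _) fun p => ?_
  simp only
  rw [mul_assoc, Real.cos_two_mul]
  nlinarith [sq_nonneg (1 - Real.cos (y * (p.1 - p.2)))]

/-- Double `y` until it first leaves `(-δ, δ)`, where the bound `N` applies. Each doubling costs a
factor `4`, exactly the scaling of `y²`. -/
lemma sq_mul_le_one_sub_normSq_charFun (G : Measure ℝ) [IsProbabilityMeasure G] {δ N : ℝ}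
    (hδ : 0 < δ) (hN : ∀ y, δ ≤ |y| → ‖charFun G y‖ ≤ N) (hN1 : N < 1) {y : ℝ} (hy : |y| ≤ δ) :
    (1 - N ^ 2) / (4 * δ ^ 2) * y ^ 2 ≤ 1 - ‖charFun G y‖ ^ 2 := by
  have hN0 : 0 ≤ N := (norm_nonneg _).trans (hN δ (le_abs_self δ))
  have hNN : 0 ≤ 1 - N ^ 2 := by nlinarith
  rcases eq_or_ne y 0 with rfl | hy0
  · simp
  have hypos : 0 < |y| := abs_pos.2 hy0
  have hiter : ∀ k : ℕ, 1 - ‖charFun G (2 ^ k * y)‖ ^ 2 ≤ 4 ^ k * (1 - ‖charFun G y‖ ^ 2) := by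
    intro k
    induction k with
    | zero => simp
    | succ k ih =>
      calc _ = 1 - ‖charFun G (2 * (2 ^ k * y))‖ ^ 2 := by rw [pow_succ']; ring_nf
        _ ≤ 4 * (1 - ‖charFun G (2 ^ k * y)‖ ^ 2) := one_sub_normSq_charFun_two_mul_le G _
        _ ≤ 4 * (4 ^ k * (1 - ‖charFun G y‖ ^ 2)) := by gcongr
        _ = _ := by ring
  obtain ⟨k, hk1, hk2⟩ := exists_nat_pow_near (x := δ / |y|) (y := (2 : ℝ))
    ((one_le_div hypos).2 hy) (by norm_num)
  have e1 : δ ≤ |2 ^ (k + 1) * y| := by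
    rw [abs_mul, abs_of_pos (by positivity : (0 : ℝ) < 2 ^ (k + 1)), ← div_le_iff₀ hypos]
    exact hk2.le
  have e2 : (4 : ℝ) ^ (k + 1) * y ^ 2 ≤ 4 * δ ^ 2 := by
    have : 2 ^ k * |y| ≤ δ := by rwa [← le_div_iff₀ hypos]
    have h4 : (4 : ℝ) ^ k = (2 ^ k) ^ 2 := by rw [← pow_mul, mul_comm, pow_mul]; norm_num
    rw [pow_succ, h4, ← sq_abs y]
    have : (2 ^ k * |y|) ^ 2 ≤ δ ^ 2 := by gcongr
    nlinarith
  have e3 : 1 - N ^ 2 ≤ 1 - ‖charFun G (2 ^ (k + 1) * y)‖ ^ 2 := by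
    have := hN _ e1
    gcongr
  have e4 := e3.trans (hiter (k + 1))
  have hy2 : 0 < y ^ 2 := by positivity
  rw [div_mul_eq_mul_div, div_le_iff₀ (by positivity)]
  have hD : 0 ≤ 1 - ‖charFun G y‖ ^ 2 := by
    have : ‖charFun G y‖ ≤ 1 := norm_charFun_le_one _
    nlinarith [norm_nonneg (charFun G y)]
  calc (1 - N ^ 2) * y ^ 2 ≤ (4 ^ (k + 1) * (1 - ‖charFun G y‖ ^ 2)) * y ^ 2 := by gcongr
    _ = (1 - ‖charFun G y‖ ^ 2) * (4 ^ (k + 1) * y ^ 2) := by ring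
    _ ≤ _ := by gcongr

/-- The real part is continuous, equals `1` at `0` and has no zero on `[-δ, δ]`, so it stays
positive there. -/
lemma le_charFun_re_of_le_abs (G : Measure ℝ) [IsProbabilityMeasure G] {δ r : ℝ} (hr : 0 < r)
    (h : ∀ y, |y| ≤ δ → r ≤ |(charFun G y).re|) {y : ℝ} (hy : |y| ≤ δ) :
    r ≤ (charFun G y).re := by
  have hc : Continuous fun y : ℝ => (charFun G y).re := Complex.continuous_re.comp continuous_charFun
  rcases le_abs.1 (h y hy) with h1 | h1
  · exact h1
  · exfalso
    have h0 : (charFun G (0 : ℝ)).re = 1 := by simp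
    have hm : (0 : ℝ) ∈ Set.Icc (charFun G y).re (charFun G (0 : ℝ)).re := by
      rw [h0]; exact ⟨by linarith, zero_le_one⟩
    obtain ⟨w, hw, hw0⟩ := intermediate_value_uIcc hc.continuousOn (Set.Icc_subset_uIcc hm)
    have hwδ : |w| ≤ δ := by
      refine le_trans ?_ hy
      have := Set.abs_sub_right_of_mem_uIcc hw
      simpa using this
    have := h w hwδ
    simp only at hw0
    rw [hw0, abs_zero] at this
    linarith

/-- Averaging over `[-δ, δ]` gives `r ≤ ∫ sinc(δ x) G(dx)`, and `sinc(δ x)` is at most `r / 2` once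
`|x| > 2 / (δ r)`. Hence a fixed share of the mass lies in a fixed interval. -/
lemma half_le_measureReal_of_le_charFun_re (G : Measure ℝ) [IsProbabilityMeasure G] {δ r : ℝ}
    (hδ : 0 < δ) (hr : 0 < r) (h : ∀ y, |y| ≤ δ → r ≤ (charFun G y).re) :
    r / 2 ≤ G.real {x | |x| ≤ 2 / (δ * r)} := by
  have h1 := integral_charFun_Icc (μ := G) hδ
  have hc : Continuous fun y : ℝ => charFun G y := continuous_charFun
  have h2 : 2 * δ * r ≤ (∫ t in -δ..δ, charFun G t).re := by
    have e : (∫ t in -δ..δ, charFun G t).re = ∫ t in -δ..δ, (charFun G t).re :=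
      (Complex.reCLM.intervalIntegral_comp_comm (hc.intervalIntegrable _ _)).symm
    rw [e]
    have := intervalIntegral.integral_mono_on (a := -δ) (b := δ) (by linarith)
      (μ := volume) (f := fun _ => r) (g := fun t => (charFun G t).re)
      (continuous_const.intervalIntegrable _ _)
      ((Complex.continuous_re.comp hc).intervalIntegrable _ _)
      fun t ht => h t (abs_le.2 ht)
    simp only [intervalIntegral.integral_const, smul_eq_mul] at this
    linarith
  have h3 : (∫ t in -δ..δ, charFun G t).re = 2 * δ * ∫ x, Real.sinc (δ * x) ∂G := by
    rw [h1]; norm_cast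
  have h4 : r ≤ ∫ x, Real.sinc (δ * x) ∂G := by
    rw [h3] at h2
    exact le_of_mul_le_mul_left h2 (by positivity)
  set A := {x : ℝ | |x| ≤ 2 / (δ * r)} with hA
  have hAm : MeasurableSet A := measurableSet_le (by fun_prop) (by fun_prop)
  have h5 : ∫ x, Real.sinc (δ * x) ∂G ≤ ∫ x, (A.indicator 1 x + r / 2) ∂G := by
    refine integral_mono (Integrable.of_bound (by fun_prop) 1
      (ae_of_all _ fun x => Real.abs_sinc_le_one _))
      (((integrable_const 1).indicator hAm).add (integrable_const _)) fun x => ?_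
    simp only
    by_cases hx : x ∈ A
    · rw [Set.indicator_of_mem hx]
      have := Real.sinc_le_one (δ * x)
      simp only [Pi.one_apply]
      linarith
    · rw [Set.indicator_of_notMem hx, zero_add]
      simp only [hA, Set.mem_ofPred_eq, not_le] at hx
      have hx0 : 0 < |x| := lt_trans (by positivity) hx
      have hne : δ * x ≠ 0 := mul_ne_zero hδ.ne' (abs_pos.1 hx0)
      refine (le_abs_self _).trans ?_
      rw [Real.sinc_of_ne_zero hne, abs_div, div_le_iff₀ (abs_pos.2 hne), abs_mul, abs_of_pos hδ]
      refine (Real.abs_sin_le_one _).trans ?_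
      rw [div_lt_iff₀ (by positivity)] at hx
      linarith
  rw [integral_add ((integrable_const 1).indicator hAm) (integrable_const _),
    integral_indicator_one hAm] at h5
  simp at h5
  linarith

lemma one_sub_cos_add_le (s t : ℝ) :
    1 - Real.cos (s + t) ≤ 2 * (1 - Real.cos s) + 2 * (1 - Real.cos t) := by
  have h1 : ∀ v : ℝ, 1 - Real.cos v = 2 * Real.sin (v / 2) ^ 2 := fun v => by
    have := Real.cos_two_mul (v / 2)
    rw [mul_div_cancel₀ _ (two_ne_zero)] at this
    rw [this, Real.cos_sq']; ring
  rw [h1, h1, h1, add_div, Real.sin_add]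
  have h2 : (Real.sin (s / 2) * Real.cos (t / 2) + Real.cos (s / 2) * Real.sin (t / 2)) ^ 2 ≤
      2 * (Real.sin (s / 2) * Real.cos (t / 2)) ^ 2 +
        2 * (Real.cos (s / 2) * Real.sin (t / 2)) ^ 2 := by
    nlinarith [sq_nonneg (Real.sin (s / 2) * Real.cos (t / 2) - Real.cos (s / 2) * Real.sin (t / 2))]
  have h3 : (Real.sin (s / 2) * Real.cos (t / 2)) ^ 2 ≤ Real.sin (s / 2) ^ 2 := by
    rw [mul_pow]; exact mul_le_of_le_one_right (sq_nonneg _) (Real.cos_sq_le_one _)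
  have h4 : (Real.cos (s / 2) * Real.sin (t / 2)) ^ 2 ≤ Real.sin (t / 2) ^ 2 := by
    rw [mul_pow]; exact mul_le_of_le_one_left (sq_nonneg _) (Real.cos_sq_le_one _)
  linarith

/-- Undoes the symmetrization: for independent copies write `x₂ = (x₂ - x₁) + x₁` and keep only
`|x₁| ≤ K`, where `1 - cos(y x₁) ≤ K² y² / 2`. -/
lemma measureReal_mul_one_sub_charFun_re_le (G : Measure ℝ) [IsProbabilityMeasure G] {K : ℝ}
    (y : ℝ) :
    G.real {x | |x| ≤ K} * (1 - (charFun G y).re) ≤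
      2 * (1 - ‖charFun G y‖ ^ 2) + K ^ 2 * y ^ 2 := by
  set A := {x : ℝ | |x| ≤ K} with hA
  have hAm : MeasurableSet A := measurableSet_le (by fun_prop) (by fun_prop)
  have hnn : ∀ t, 0 ≤ 1 - Real.cos t := fun t => by linarith [Real.cos_le_one t]
  have h1 : 1 - (charFun G y).re = ∫ x, (1 - Real.cos (y * x)) ∂G := by
    rw [integral_sub (integrable_const _) (integrable_cos_comp (by fun_prop)), charFun_re]
    simp
  have hi1 : Integrable (fun x => 1 - Real.cos (y * x)) G :=
    (integrable_const _).sub (integrable_cos_comp (by fun_prop))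
  have hi2 : Integrable (fun p : ℝ × ℝ => 1 - Real.cos (y * (p.1 - p.2))) (G.prod G) :=
    (integrable_const _).sub (integrable_cos_comp (by fun_prop))
  have hi3 : Integrable (A.indicator (1 : ℝ → ℝ)) G := (integrable_const 1).indicator hAm
  rw [h1, one_sub_normSq_charFun_eq, ← integral_indicator_one hAm, ← integral_prod_mul,
    ← integral_const_mul]
  have h2 : K ^ 2 * y ^ 2 = ∫ _ : ℝ × ℝ, K ^ 2 * y ^ 2 ∂(G.prod G) := by simp
  rw [h2, ← integral_add (hi2.const_mul 2) (integrable_const _)]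
  refine integral_mono (hi3.mul_prod hi1) ((hi2.const_mul 2).add (integrable_const _)) fun p => ?_
  simp only
  have e0 := hnn (y * (p.1 - p.2))
  by_cases hp : p.1 ∈ A
  · rw [Set.indicator_of_mem hp, Pi.one_apply, one_mul]
    have e1 := one_sub_cos_add_le (y * (p.2 - p.1)) (y * p.1)
    rw [show y * (p.2 - p.1) + y * p.1 = y * p.2 by ring] at e1
    rw [show y * (p.2 - p.1) = -(y * (p.1 - p.2)) by ring, Real.cos_neg] at e1
    have e2 := Real.one_sub_sq_div_two_le_cos (x := y * p.1)
    have e3 : p.1 ^ 2 ≤ K ^ 2 := by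
      rw [← sq_abs]
      exact pow_le_pow_left₀ (abs_nonneg _) hp 2
    nlinarith [mul_le_mul_of_nonneg_left e3 (sq_nonneg y)]
  · rw [Set.indicator_of_notMem hp, zero_mul]
    positivity

/-- If `|Re θ| ≥ r` on `[-δ, δ]` and `|θ| ≤ N < 1` outside, then `1 - Re θ` is controlled by
`1 - |θ|²` on `[-δ, δ]`, with a constant that depends only on `δ`, `r`, `N`. -/
theorem exists_one_sub_charFun_re_le {δ r N : ℝ} (hδ : 0 < δ) (hr : 0 < r) (hN1 : N < 1)
    (hN0 : 0 ≤ N) : ∃ c : ℝ, 0 < c ∧ ∀ (G : Measure ℝ) [IsProbabilityMeasure G],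
      (∀ y, δ ≤ |y| → ‖charFun G y‖ ≤ N) → (∀ y, |y| ≤ δ → r ≤ |(charFun G y).re|) →
        ∀ y, |y| ≤ δ → ‖charFun G y‖ ≤ Real.exp (-(c * (1 - (charFun G y).re))) := by
  have hNN : 0 < 1 - N ^ 2 := by nlinarith
  set K := 2 / (δ * r) with hK
  set q := (1 - N ^ 2) / (4 * δ ^ 2) with hq
  have hq0 : 0 < q := by positivity
  -- The mass bound `r / 2` and `K² y² ≤ (K² / q) D` give all but the last `/ 2`, which comes from
  -- the square root in `|θ|² ≤ e^{-D}`.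
  refine ⟨r / 2 / (2 + K ^ 2 / q) / 2, by positivity, fun G _ hG1 hG2 y hy => ?_⟩
  set D := 1 - ‖charFun G y‖ ^ 2 with hD
  have h1 := sq_mul_le_one_sub_normSq_charFun G hδ hG1 hN1 hy
  have h2 := half_le_measureReal_of_le_charFun_re G hδ hr
    fun y hy => le_charFun_re_of_le_abs G hr hG2 hy
  have h3 := measureReal_mul_one_sub_charFun_re_le G (K := K) y
  have h0 : 0 ≤ 1 - (charFun G y).re := by
    have := (Complex.re_le_norm (charFun G y)).trans (norm_charFun_le_one (μ := G) y)
    linarith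
  have h4 : K ^ 2 * y ^ 2 ≤ K ^ 2 / q * D := by
    rw [div_mul_eq_mul_div, le_div_iff₀ hq0, mul_assoc, mul_comm (y ^ 2)]
    gcongr
  have h5 : r / 2 * (1 - (charFun G y).re) ≤ (2 + K ^ 2 / q) * D := by
    calc _ ≤ _ := mul_le_mul_of_nonneg_right h2 h0
      _ ≤ _ := h3
      _ ≤ 2 * D + K ^ 2 / q * D := by gcongr
      _ = _ := by ring
  have h6 : r / 2 / (2 + K ^ 2 / q) * (1 - (charFun G y).re) ≤ D := by
    rw [div_mul_eq_mul_div, div_le_iff₀ (by positivity)]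
    linarith
  set w := r / 2 / (2 + K ^ 2 / q) with hw
  refine le_of_pow_le_pow_left₀ two_ne_zero (Real.exp_pos _).le ?_
  rw [← Real.exp_nat_mul]
  calc ‖charFun G y‖ ^ 2 = -D + 1 := by rw [hD]; ring
    _ ≤ Real.exp (-D) := Real.add_one_le_exp _
    _ ≤ _ := by
      apply Real.exp_le_exp.2
      push_cast
      linarith

/-! ### Powers, exponentials and decay. -/

lemma norm_pow_sub_pow_le_of_norm_le {x y : ℂ} {ρ : ℝ} (hx : ‖x‖ ≤ ρ) (hy : ‖y‖ ≤ ρ) (k : ℕ) :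
    ‖x ^ k - y ^ k‖ ≤ k * ρ ^ (k - 1) * ‖x - y‖ := by
  have hρ : 0 ≤ ρ := (norm_nonneg x).trans hx
  rw [← (Commute.all x y).geom_sum₂_mul, norm_mul]
  gcongr
  refine (norm_sum_le_of_le _ (f := fun i => x ^ i * y ^ (k - 1 - i)) (n := fun _ => ρ ^ (k - 1))
    fun i hi => ?_).trans_eq (by simp)
  rw [norm_mul, norm_pow, norm_pow]
  have : i + (k - 1 - i) = k - 1 := by have := Finset.mem_range.1 hi; omega
  calc ‖x‖ ^ i * ‖y‖ ^ (k - 1 - i) ≤ ρ ^ i * ρ ^ (k - 1 - i) := by gcongr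
    _ = _ := by rw [← pow_add, this]

/-- Comparison of the `k`-th power of a number of modulus at most one with the accompanying
exponential. -/
lemma norm_pow_sub_exp_le {f : ℂ} {c : ℝ} (hc0 : 0 ≤ c) (hc1 : c ≤ 1) (hf1 : ‖f‖ ≤ 1)
    (hf : ‖f‖ ≤ Real.exp (-(c * (1 - f.re)))) {k : ℕ} (hk : 2 ≤ k) :
    ‖f ^ k - Complex.exp (-(k * (1 - f)))‖ ≤
      Real.exp 2 * (1 / k) * ‖k * (1 - f)‖ ^ 2 * Real.exp (-(c / 2 * (k * (1 - f)).re)) := by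
  have hw : 0 ≤ 1 - f.re := by linarith [(Complex.re_le_norm f).trans hf1]
  have hk0 : (0 : ℝ) < k := by positivity
  have hexp : Complex.exp (-(k * (1 - f))) = Complex.exp (f - 1) ^ k := by
    rw [← Complex.exp_nat_mul]; ring_nf
  -- Since `c ≤ 1`, the accompanying exponential obeys the same bound as `f`.
  have hy : ‖Complex.exp (f - 1)‖ ≤ Real.exp (-(c * (1 - f.re))) := by
    rw [Complex.norm_exp]
    apply Real.exp_le_exp.2
    simp only [Complex.sub_re, Complex.one_re]
    nlinarith
  -- The constant `e²` is the bound for `e^{|f - 1|}`, as `|f - 1| ≤ 2`.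
  have h1 : ‖f - Complex.exp (f - 1)‖ ≤ Real.exp 2 * ‖1 - f‖ ^ 2 := by
    have h := Complex.norm_exp_sub_sum_le_norm_mul_exp (f - 1) 2
    have hn : ‖f - 1‖ ≤ 2 := (norm_sub_le _ _).trans (by rw [norm_one]; linarith)
    rw [norm_sub_rev f 1] at *
    rw [norm_sub_rev]
    have e : Complex.exp (f - 1) - ∑ m ∈ Finset.range 2, (f - 1) ^ m / (m.factorial : ℂ) =
        Complex.exp (f - 1) - f := by
      simp [Finset.sum_range_succ]
    rw [e] at h
    refine h.trans ?_
    rw [mul_comm]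
    gcongr
  -- Here `k - 1 ≥ k / 2`, which accounts for the rate `c / 2`.
  have h2 : Real.exp (-(c * (1 - f.re))) ^ (k - 1) ≤
      Real.exp (-(c / 2 * (k * (1 - f)).re)) := by
    rw [← Real.exp_nat_mul]
    apply Real.exp_le_exp.2
    have e1 : ((k : ℂ) * (1 - f)).re = k * (1 - f.re) := by simp
    have e2 : ((k - 1 : ℕ) : ℝ) = k - 1 := by push_cast [Nat.cast_sub (show 1 ≤ k by omega)]; ring
    rw [e1, e2]
    have hk' : (2 : ℝ) ≤ k := by exact_mod_cast hk
    have : 0 ≤ c * (1 - f.re) := by positivity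
    nlinarith
  rw [hexp]
  refine (norm_pow_sub_pow_le_of_norm_le hf hy k).trans ?_
  rw [norm_mul, Complex.norm_natCast, mul_pow]
  calc (k : ℝ) * Real.exp (-(c * (1 - f.re))) ^ (k - 1) * ‖f - Complex.exp (f - 1)‖
      ≤ k * Real.exp (-(c / 2 * (k * (1 - f)).re)) * (Real.exp 2 * ‖1 - f‖ ^ 2) := by gcongr
    _ = _ := by field_simp

/-- Mean value inequality on a half-plane, where the derivative of `e^{-w}` has norm at most
`e^{-m}`. -/
lemma norm_exp_neg_sub_exp_neg_le {x y : ℂ} {m : ℝ} (hx : m ≤ x.re) (hy : m ≤ y.re) :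
    ‖Complex.exp (-x) - Complex.exp (-y)‖ ≤ Real.exp (-m) * ‖x - y‖ := by
  have hconv : Convex ℝ {w : ℂ | m ≤ w.re} := convex_halfSpace_re_ge m
  have h := hconv.norm_image_sub_le_of_norm_hasDerivWithin_le
    (f := fun w => Complex.exp (-w)) (f' := fun w => Complex.exp (-w) * -1) (C := Real.exp (-m))
    (fun w _ => ((hasDerivAt_neg w).cexp).hasDerivWithinAt) (fun w hw => by
      rw [norm_mul, norm_neg, norm_one, mul_one, Complex.norm_exp, Complex.neg_re]
      exact Real.exp_le_exp.2 (neg_le_neg hw)) hy hx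
  exact h

/-- Exponential decay along a power of `|z|` beats any power of `1 + z²`. -/
lemma exists_exp_neg_le_inv_pow {c κ R : ℝ} (hc : 0 < c) (hκ : 0 < κ) (K : ℕ) :
    ∃ C : ℝ, 0 < C ∧ ∀ z w : ℝ, 0 ≤ w → (R ≤ |z| → c * |z| ^ κ ≤ w) →
      Real.exp (-w) ≤ C * ((1 + z ^ 2) ^ K)⁻¹ := by
  -- Then `|z| ^ (2 K) ≤ |z| ^ (κ m)` for `|z| ≥ 1`, and `e^{-x} ≤ m! / x ^ m` supplies the decay.
  -- The first summand of the witness below covers `|z| < R'`.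
  obtain ⟨m, hm⟩ := exists_nat_ge (2 * K / κ)
  rw [div_le_iff₀ hκ] at hm
  set R' := max R 1 with hR'
  refine ⟨(1 + R' ^ 2) ^ K + 2 ^ K * m.factorial / c ^ m, by positivity, fun z w hw hz => ?_⟩
  rw [← div_eq_mul_inv, le_div_iff₀ (by positivity)]
  rcases lt_or_ge |z| R' with h | h
  · have h1 : z ^ 2 ≤ R' ^ 2 := by rw [← sq_abs]; gcongr
    have h2 : Real.exp (-w) ≤ 1 := Real.exp_le_one_iff.2 (by linarith)
    calc Real.exp (-w) * (1 + z ^ 2) ^ K ≤ 1 * (1 + R' ^ 2) ^ K := by gcongr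
      _ ≤ _ := by rw [one_mul]; exact le_add_of_nonneg_right (by positivity)
  · have hz1 : 1 ≤ |z| := (le_max_right _ _).trans h
    have hw' := hz ((le_max_left _ _).trans h)
    have hx : 0 < c * |z| ^ κ := by positivity
    have h1 : (c * |z| ^ κ) ^ m / m.factorial ≤ Real.exp w :=
      (Real.pow_div_factorial_le_exp _ hx.le m).trans (Real.exp_le_exp.2 hw')
    have h2 : (1 + z ^ 2) ^ K ≤ 2 ^ K * (|z| ^ κ) ^ m := by
      have e1 : 1 + z ^ 2 ≤ 2 * |z| ^ 2 := by
        have := one_le_pow₀ (n := 2) hz1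
        rw [sq_abs] at *
        linarith
      have e2 : (|z| ^ 2) ^ K ≤ (|z| ^ κ) ^ m := by
        rw [← pow_mul, ← Real.rpow_natCast, ← Real.rpow_natCast, ← Real.rpow_mul (abs_nonneg _)]
        apply Real.rpow_le_rpow_of_exponent_le hz1
        push_cast
        linarith
      calc _ ≤ (2 * |z| ^ 2) ^ K := by gcongr
        _ = 2 ^ K * (|z| ^ 2) ^ K := mul_pow _ _ _
        _ ≤ _ := by gcongr
    have h3 : Real.exp (-w) * (|z| ^ κ) ^ m ≤ m.factorial / c ^ m := by
      rw [Real.exp_neg, inv_mul_le_iff₀ (Real.exp_pos _), mul_div_assoc', le_div_iff₀ (by positivity)]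
      rw [div_le_iff₀ (by positivity), mul_pow] at h1
      linarith
    calc Real.exp (-w) * (1 + z ^ 2) ^ K ≤ Real.exp (-w) * (2 ^ K * (|z| ^ κ) ^ m) := by gcongr
      _ = 2 ^ K * (Real.exp (-w) * (|z| ^ κ) ^ m) := by ring
      _ ≤ 2 ^ K * (m.factorial / c ^ m) := by gcongr
      _ = 2 ^ K * m.factorial / c ^ m := by ring
      _ ≤ _ := le_add_of_nonneg_left (by positivity)

/-! ### Quantitative consequences of conditions D, E and H. -/

lemma CondD.exists_integral_normSq_charFun_le {G : ℕ → Measure ℝ} [∀ n, IsProbabilityMeasure (G n)]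
    {g : ℕ → ℝ → ℝ} (hg : ∀ n, IsDensity (G n) (g n)) (hD : CondD g) :
    ∃ B : ℝ, 0 ≤ B ∧ ∀ n, Integrable (fun z : ℝ => ‖charFun (G n) z‖ ^ 2) ∧
      ∫ z, ‖charFun (G n) z‖ ^ 2 ≤ B := by
  set T := ⨆ n, ∫⁻ x, ENNReal.ofReal (g n x ^ 2) with hT
  have hT' : T < ⊤ := hD
  refine ⟨(ENNReal.ofReal (2 * Real.pi) * T).toReal, ENNReal.toReal_nonneg, fun n => ?_⟩
  have h1 : ∫⁻ z, ENNReal.ofReal (‖charFun (G n) z‖ ^ 2) ≤ ENNReal.ofReal (2 * Real.pi) * T :=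
    (lintegral_normSq_charFun_le (hg n)).trans (mul_le_mul_right (le_iSup (fun n =>
      ∫⁻ x, ENNReal.ofReal (g n x ^ 2)) n) _)
  have hfin : ENNReal.ofReal (2 * Real.pi) * T < ⊤ := ENNReal.mul_lt_top ENNReal.ofReal_lt_top hT'
  have hc : Continuous fun z : ℝ => ‖charFun (G n) z‖ ^ 2 :=
    (continuous_charFun.norm).pow 2
  have hnn : ∀ z : ℝ, 0 ≤ ‖charFun (G n) z‖ ^ 2 := fun z => by positivity
  refine ⟨⟨hc.aestronglyMeasurable, ?_⟩, ?_⟩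
  · rw [hasFiniteIntegral_iff_ofReal (ae_of_all _ hnn)]
    exact h1.trans_lt hfin
  · rw [integral_eq_lintegral_of_nonneg_ae (ae_of_all _ hnn) hc.aestronglyMeasurable]
    exact ENNReal.toReal_mono hfin.ne h1

/-- Since `ln b_n = o(a_n)`, eventually `b_n ≤ e^{ε a_n}`, while the power of `N` is at most `e^{-2
ε (a_n - 2)}`; the product is `O(e^{-ε a_n})`. The two missing factors are those reserved for
Plancherel. -/
lemma CondE.exists_mul_pow_le {a : ℕ → ℕ} {b : ℕ → ℝ} (hE : CondE a b) (hb : ∀ n, 0 < b n)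
    (ha_top : Tendsto a atTop atTop) {N : ℝ} (hN0 : 0 ≤ N) (hN1 : N < 1) :
    ∃ C : ℝ, 0 < C ∧ ∀ᶠ n in atTop, N ^ (a n - 2) * b n ≤ C * (1 / a n) := by
  -- Keeps the logarithm meaningful when `N = 0`.
  set N' := max N (1 / 2) with hN'
  have hN'0 : 0 < N' := lt_max_of_lt_right (by norm_num)
  have hN'1 : N' < 1 := max_lt hN1 (by norm_num)
  set ε := -Real.log N' / 2 with hε
  have hε0 : 0 < ε := by have := Real.log_neg hN'0 hN'1; simp only [hε]; linarith
  have hNexp : N' = Real.exp (-(2 * ε)) := by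
    rw [hε, show -(2 * (-Real.log N' / 2)) = Real.log N' by ring, Real.exp_log hN'0]
  refine ⟨Real.exp (4 * ε) / ε, by positivity, ?_⟩
  filter_upwards [hE.2.eventually (gt_mem_nhds hε0), ha_top.eventually_ge_atTop 2] with n hn ha2
  have ha0 : (0 : ℝ) < a n := by positivity
  rw [div_lt_iff₀ ha0] at hn
  have hbn : b n ≤ Real.exp (ε * a n) := by
    rw [← Real.exp_log (hb n)]; exact Real.exp_le_exp.2 hn.le
  have hpow : N ^ (a n - 2) ≤ Real.exp (-(2 * ε) * (a n - 2)) := by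
    calc N ^ (a n - 2) ≤ N' ^ (a n - 2) := pow_le_pow_left₀ hN0 (le_max_left _ _) _
      _ = Real.exp (((a n - 2 : ℕ) : ℝ) * -(2 * ε)) := by rw [hNexp, ← Real.exp_nat_mul]
      _ = _ := by rw [Nat.cast_sub ha2]; push_cast; ring_nf
  have hinv : Real.exp (-(ε * a n)) ≤ (ε * a n)⁻¹ := by
    rw [Real.exp_neg]
    gcongr
    linarith [Real.add_one_le_exp (ε * a n)]
  calc N ^ (a n - 2) * b n ≤ Real.exp (-(2 * ε) * (a n - 2)) * Real.exp (ε * a n) := by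
        have := (hb n).le
        gcongr
    _ = Real.exp (4 * ε) * Real.exp (-(ε * a n)) := by
      rw [← Real.exp_add, ← Real.exp_add]; ring_nf
    _ ≤ Real.exp (4 * ε) * (ε * a n)⁻¹ := by gcongr
    _ = _ := by field_simp

/-- From `a_n = O(n ^ t)` and `n ^ s = O(b_n)`; any `K ≥ t / (2 s)` works. It converts decay in `|z|
> δ b_n` into a factor `1 / a_n`. -/
lemma exists_le_pow_of_condH {a b : ℕ → ℝ} (hHa : CondH a) (hHb : CondH b)
    {δ : ℝ} (hδ : 0 < δ) :
    ∃ (K : ℕ) (C : ℝ), 0 < C ∧ ∀ᶠ n in atTop, a n ≤ C * (1 + (δ * b n) ^ 2) ^ K := by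
  obtain ⟨-, t, -, ht, -, hlimsup⟩ := hHa
  obtain ⟨s, -, hs, -, hliminf, -⟩ := hHb
  obtain ⟨L, hL1, hL2⟩ := exists_between hlimsup
  obtain ⟨l, hl1, hl2⟩ := exists_between hliminf
  have hev1 := eventually_lt_of_limsup_lt hL1
  have hev2 := eventually_lt_of_lt_liminf hl2
  obtain ⟨K, hK⟩ := exists_nat_ge (t / (2 * s))
  rw [div_le_iff₀ (by positivity)] at hK
  set C := L.toReal + 1 with hC
  set c := min l.toReal 1 with hc
  have hltop : l ≠ ⊤ := by
    rintro rfl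
    obtain ⟨n, hn⟩ := hev2.exists
    exact absurd hn not_top_lt
  have hc0 : 0 < c := lt_min (ENNReal.toReal_pos hl1.ne' hltop) one_pos
  refine ⟨K, C * ((c * δ) ^ 2)⁻¹ ^ K, by positivity, ?_⟩
  filter_upwards [hev1, hev2, eventually_ge_atTop 1] with n h1 h2 hn
  have hn1 : (1 : ℝ) ≤ n := by exact_mod_cast hn
  have ha1 : a n ≤ C * (n : ℝ) ^ t := by
    rw [← div_le_iff₀ (by positivity)]
    have := (ENNReal.ofReal_le_iff_le_toReal hL2.ne).1 h1.le
    linarith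
  have hb1 : c * (n : ℝ) ^ s ≤ b n := by
    rw [← le_div_iff₀ (by positivity)]
    have := (ENNReal.lt_ofReal_iff_toReal_lt hltop).1 h2
    exact (min_le_left _ _).trans this.le
  have hnt : (n : ℝ) ^ t ≤ (((n : ℝ) ^ s) ^ 2) ^ K := by
    rw [← pow_mul, ← Real.rpow_natCast, ← Real.rpow_mul (by positivity)]
    apply Real.rpow_le_rpow_of_exponent_le hn1
    push_cast
    linarith
  have hbs : ((n : ℝ) ^ s) ^ 2 ≤ ((c * δ) ^ 2)⁻¹ * (1 + (δ * b n) ^ 2) := by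
    rw [← div_eq_inv_mul, le_div_iff₀ (by positivity)]
    have : (c * (n : ℝ) ^ s) ^ 2 ≤ b n ^ 2 := by gcongr
    nlinarith [mul_le_mul_of_nonneg_left this (sq_nonneg δ)]
  calc a n ≤ C * (n : ℝ) ^ t := ha1
    _ ≤ C * (((n : ℝ) ^ s) ^ 2) ^ K := by gcongr
    _ ≤ C * (((c * δ) ^ 2)⁻¹ * (1 + (δ * b n) ^ 2)) ^ K := by gcongr
    _ = _ := by rw [mul_pow, mul_assoc]

/-! ### Existence of the limit law. -/

/-- Existence part of Lévy's continuity theorem. -/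
theorem exists_isProbabilityMeasure_charFun_eq {μ : ℕ → Measure ℝ} [∀ n, IsProbabilityMeasure (μ n)]
    {χ : ℝ → ℂ} (hχ : ContinuousAt χ 0)
    (h : ∀ t, Tendsto (fun n => charFun (μ n) t) atTop (𝓝 (χ t))) :
    ∃ P : Measure ℝ, IsProbabilityMeasure P ∧ ∀ t, charFun P t = χ t := by
  have htight := isTightMeasureSet_of_tendsto_charFun hχ h
  set ν : ℕ → ProbabilityMeasure ℝ := fun n => ⟨μ n, inferInstance⟩ with hν
  have hset : {x : Measure ℝ | ∃ m ∈ Set.range ν, (m : Measure ℝ) = x} = Set.range μ := by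
    ext x
    constructor
    · rintro ⟨_, ⟨n, rfl⟩, rfl⟩
      exact ⟨n, rfl⟩
    · rintro ⟨n, rfl⟩
      exact ⟨ν n, ⟨n, rfl⟩, rfl⟩
  have hcomp := isCompact_closure_of_isTightMeasureSet (S := Set.range ν) (by rwa [hset])
  -- A limit along a nonprincipal ultrafilter replaces the extraction of a subsequence; the full
  -- limit `χ` is also the limit along it.
  obtain ⟨P, -, hP⟩ := hcomp.ultrafilter_le_nhds' ((hyperfilter ℕ).map ν)
    (Filter.mem_of_superset (Filter.range_mem_map) subset_closure)
  have hP' : Tendsto ν (hyperfilter ℕ : Filter ℕ) (𝓝 P) := hP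
  refine ⟨P, inferInstance, fun t => ?_⟩
  have h1 := (ProbabilityMeasure.tendsto_iff_forall_integral_rclike_tendsto ℂ).1 hP'
    (BoundedContinuousFunction.innerProbChar t)
  simp_rw [← charFun_eq_integral_innerProbChar] at h1
  exact tendsto_nhds_unique h1 ((h t).mono_left Nat.hyperfilter_le_atTop)

/-! ### Rescaled laws. -/

instance isProbabilityMeasure_scaledLaw (b : ℝ) (G : Measure ℝ) [IsProbabilityMeasure G] :
    IsProbabilityMeasure (scaledLaw b G) :=
  Measure.isProbabilityMeasure_map (by fun_prop)

lemma charFun_scaledLaw (b : ℝ) (G : Measure ℝ) (z : ℝ) :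
    charFun (scaledLaw b G) z = charFun G (z / b) := by
  have := charFun_map_mul (μ := G) b⁻¹ z
  rw [scaledLaw, div_eq_inv_mul, ← this]
  simp_rw [div_eq_inv_mul]

lemma isDensity_scaledLaw {b : ℝ} (hb : 0 < b) {G : Measure ℝ} {g : ℝ → ℝ} (hg : IsDensity G g) :
    IsDensity (scaledLaw b G) (fun x => b * g (b * x)) := by
  have hm : Measurable fun x => b * g (b * x) :=
    (hg.measurable.comp (measurable_const_mul b)).const_mul b
  refine ⟨hm, fun x => mul_nonneg hb.le (hg.nonneg _), ?_⟩
  ext s hs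
  have hgm := hg.measurable.ennreal_ofReal
  rw [scaledLaw, Measure.map_apply (by fun_prop) hs, withDensity_apply _ hs, hg.eq_withDensity,
    withDensity_apply _ (hs.preimage (by fun_prop)), ← lintegral_indicator hs,
    ← lintegral_indicator (hs.preimage (by fun_prop))]
  have h := Real.map_volume_mul_left hb.ne'
  have h2 : ∫⁻ x, ((fun u : ℝ => u / b) ⁻¹' s).indicator (fun x => ENNReal.ofReal (g x)) x
      ∂(Measure.map (b * ·) volume) =
      ∫⁻ x, ENNReal.ofReal |b⁻¹| *
        ((fun u : ℝ => u / b) ⁻¹' s).indicator (fun x => ENNReal.ofReal (g x)) x := by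
    rw [h, lintegral_smul_measure, lintegral_const_mul _ (hgm.indicator (hs.preimage (by fun_prop)))]
    rfl
  rw [lintegral_map (hgm.indicator (hs.preimage (by fun_prop))) (by fun_prop),
    lintegral_const_mul _ (hgm.indicator (hs.preimage (by fun_prop)))] at h2
  have h3 : ∀ x, s.indicator (fun x => ENNReal.ofReal (b * g (b * x))) x = ENNReal.ofReal b *
      ((fun u : ℝ => u / b) ⁻¹' s).indicator (fun x => ENNReal.ofReal (g x)) (b * x) := by
    intro x
    have e : b * x / b = x := by field_simp
    by_cases hx : x ∈ s
    · rw [Set.indicator_of_mem hx, Set.indicator_of_mem (by simpa [e] using hx),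
        ENNReal.ofReal_mul hb.le]
    · rw [Set.indicator_of_notMem hx, Set.indicator_of_notMem (by simpa [e] using hx), mul_zero]
  simp_rw [h3]
  rw [lintegral_const_mul' _ _ ENNReal.ofReal_ne_top, h2,
    ← mul_assoc, ← ENNReal.ofReal_mul hb.le, abs_of_pos (by positivity), mul_inv_cancel₀ hb.ne',
    ENNReal.ofReal_one, one_mul]

/-! ### Comparison of exponents and convergence of the row sums. -/

/-- Boundedness lets the real suprema `gammaRe` and `gammaIm` dominate their terms; an unbounded
real supremum would be `0` by convention. -/
lemma bddAbove_norm_phi_sub {M M' : Measure ℝ} (hM : IsCanonical M) (hM' : IsCanonical M') :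
    BddAbove (Set.range fun z : ℝ => ‖phi M z - phi M' z‖ / (1 + z ^ 2)) := by
  refine ⟨8 * (∫ u, (1 + u ^ 2)⁻¹ ∂M) + 8 * (∫ u, (1 + u ^ 2)⁻¹ ∂M'), ?_⟩
  rintro _ ⟨z, rfl⟩
  simp only
  rw [div_le_iff₀ (by positivity), add_mul]
  exact (norm_sub_le _ _).trans (add_le_add (norm_phi_le hM z) (norm_phi_le hM' z))

lemma norm_phi_sub_le {M M' : Measure ℝ} (hM : IsCanonical M) (hM' : IsCanonical M') (z : ℝ) :
    ‖phi M z - phi M' z‖ ≤ (gammaRe M M' + gammaIm M M') * (1 + z ^ 2) := by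
  obtain ⟨B, hB⟩ := bddAbove_norm_phi_sub hM hM'
  have hbd : ∀ z : ℝ, ‖phi M z - phi M' z‖ / (1 + z ^ 2) ≤ B := fun z => hB ⟨z, rfl⟩
  have h1 : |(phi M z).re - (phi M' z).re| / (1 + z ^ 2) ≤ gammaRe M M' := by
    refine le_ciSup (f := fun z : ℝ => |(phi M z).re - (phi M' z).re| / (1 + z ^ 2)) ⟨B, ?_⟩ z
    rintro _ ⟨z, rfl⟩
    refine le_trans ?_ (hbd z)
    simp only
    gcongr
    rw [← Complex.sub_re]
    exact Complex.abs_re_le_norm _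
  have h2 : |(phi M z).im - (phi M' z).im| / (1 + z ^ 2) ≤ gammaIm M M' := by
    refine le_ciSup (f := fun z : ℝ => |(phi M z).im - (phi M' z).im| / (1 + z ^ 2)) ⟨B, ?_⟩ z
    rintro _ ⟨z, rfl⟩
    refine le_trans ?_ (hbd z)
    simp only
    gcongr
    rw [← Complex.sub_im]
    exact Complex.abs_im_le_norm _
  rw [div_le_iff₀ (by positivity)] at h1 h2
  rw [← Complex.sub_re] at h1
  rw [← Complex.sub_im] at h2
  refine (Complex.norm_le_abs_re_add_abs_im _).trans ?_
  rw [add_mul]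
  exact add_le_add h1 h2

lemma norm_psi_sub_le {M M' : Measure ℝ} (hM : IsCanonical M) (hM' : IsCanonical M') (β β' z : ℝ) :
    ‖psi M' β' z - psi M β z‖ ≤
      (gammaRe M M' + gammaIm M M' + |β' - β|) * (1 + z ^ 2) := by
  have h1 : psi M' β' z - psi M β z =
      -(phi M z - phi M' z) + -Complex.I * ((β' - β) * z : ℝ) := by
    rw [psi, psi]; push_cast; ring
  have hz : |z| ≤ 1 + z ^ 2 := by rw [← sq_abs z]; nlinarith [sq_nonneg (|z| - 1)]
  rw [h1, add_mul _ |β' - β|]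
  refine (norm_add_le _ _).trans (add_le_add ?_ ?_)
  · rw [norm_neg]; exact norm_phi_sub_le hM hM' z
  · rw [norm_mul, norm_neg, Complex.norm_I, one_mul, Complex.norm_real, Real.norm_eq_abs, abs_mul]
    gcongr

/-- Testing proper convergence on `(1 + u²)⁻¹` shows that these integrals converge, hence are
bounded in `n`. -/
lemma TendstoProperly.exists_norm_phi_le {Mn : ℕ → Measure ℝ} {M : Measure ℝ}
    (h : TendstoProperly Mn M) (hMn : ∀ n, IsCanonical (Mn n)) (hM : IsCanonical M) :
    ∃ C : ℝ, 0 ≤ C ∧ ∀ n z, ‖phi (Mn n) z‖ ≤ C * (1 + z ^ 2) := by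
  have hc : Continuous fun u : ℝ => (((1 + u ^ 2)⁻¹ : ℝ) : ℂ) :=
    Complex.continuous_ofReal.comp (Continuous.inv₀ (by fun_prop) fun u => by positivity)
  have h1 := h.tendsto_integral hMn hM hc (K := 1) fun u => by
    rw [Complex.norm_real, Real.norm_of_nonneg (by positivity), one_mul]
  obtain ⟨C, hC⟩ := h1.norm.bddAbove_range
  have hC' : ∀ n, ∫ u, (1 + u ^ 2)⁻¹ ∂(Mn n) ≤ C := by
    intro n
    have := hC ⟨n, rfl⟩
    simp only [integral_complex_ofReal, Complex.norm_real] at this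
    exact (le_abs_self _).trans this
  have hnn : 0 ≤ ∫ u, (1 + u ^ 2)⁻¹ ∂(Mn 0) := integral_nonneg fun u => by positivity
  refine ⟨8 * C, by linarith [hC' 0], fun n z => (norm_phi_le (hMn n) z).trans ?_⟩
  gcongr
  exact hC' n

lemma norm_psi_le {M : Measure ℝ} {C : ℝ} {z : ℝ} (h : ‖phi M z‖ ≤ C * (1 + z ^ 2)) (β : ℝ) :
    ‖psi M β z‖ ≤ (C + |β|) * (1 + z ^ 2) := by
  have hz : |z| ≤ 1 + z ^ 2 := by rw [← sq_abs z]; nlinarith [sq_nonneg (|z| - 1)]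
  have : -Complex.I * β * z = -Complex.I * ((β * z : ℝ) : ℂ) := by push_cast; ring
  rw [psi, add_comm, add_mul, this]
  refine (norm_add_le _ _).trans (add_le_add h ?_)
  rw [norm_mul, norm_neg, Complex.norm_I, one_mul, Complex.norm_real, Real.norm_eq_abs, abs_mul]
  gcongr

lemma continuous_psi {M : Measure ℝ} (hM : IsCanonical M) (β : ℝ) : Continuous (psi M β) := by
  have := continuous_phi hM
  unfold psi
  fun_prop

/-- Conditions B and F give a common polynomial lower bound for the real parts of the exponents. -/
lemma exists_rpow_le_phi_re {a : ℕ → ℕ} {b : ℕ → ℝ} {F : ℕ → Measure ℝ}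
    [∀ n, IsProbabilityMeasure (F n)] {M : Measure ℝ} {β δ : ℝ} (hM : IsCanonical M)
    (hB : CondB M β) (hF : CondF a b F M δ) :
    ∃ c κ R : ℝ, 0 < c ∧ 0 < κ ∧ (∀ z, R ≤ |z| → c * |z| ^ κ ≤ (phi M z).re) ∧
      ∀ n z, R ≤ |z| → |z| ≤ δ * b n →
        c * |z| ^ κ ≤ (phi (arrayMeasure (a n) (F n)) z).re := by
  obtain ⟨α, cB, RB, hα, -, hcB, hB⟩ := hB
  obtain ⟨cF, κF, hcF, hκF, -, hF⟩ := hF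
  have hmono : ∀ z κ c : ℝ, max RB 1 ≤ |z| → min cB cF ≤ c → min α κF ≤ κ →
      min cB cF * |z| ^ min α κF ≤ c * |z| ^ κ := by
    intro z κ c hz hc hκ
    have hz1 : 1 ≤ |z| := (le_max_right _ _).trans hz
    exact mul_le_mul hc (Real.rpow_le_rpow_of_exponent_le hz1 hκ) (by positivity)
      ((lt_min hcB hcF).le.trans hc)
  have hphi : ∀ z, max RB 1 ≤ |z| → min cB cF * |z| ^ min α κF ≤ (phi M z).re := by
    intro z hz
    have := hB z ((le_max_left _ _).trans hz)
    rw [psi_re] at this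
    exact (hmono z α cB hz (min_le_left _ _) (min_le_left _ _)).trans this
  refine ⟨min cB cF, min α κF, max RB 1, lt_min hcB hcF, lt_min hα hκF, hphi, fun n z hz hzδ => ?_⟩
  rcases hF n with h | h
  · refine (hmono z κF cF hz (min_le_right _ _) (min_le_right _ _)).trans ((h z hzδ).trans_eq ?_)
    rw [integral_one_sub_cos_symm, ← psi_re _ (a n * sinMean (F n)), psi_arrayMeasure]
    simp
  · exact (hphi z hz).trans (phi_re_le_of_symm_le hM (isCanonical_arrayMeasure _ _) h z)

lemma tendsto_charFun_pow {a : ℕ → ℕ} {F : ℕ → Measure ℝ} [∀ n, IsProbabilityMeasure (F n)]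
    {M : Measure ℝ} {β : ℝ} (hM : IsCanonical M) (ha_top : Tendsto a atTop atTop)
    (hconv : TendstoProperly (fun n => arrayMeasure (a n) (F n)) M)
    (hβ : Tendsto (fun n => a n * sinMean (F n)) atTop (𝓝 β)) (z : ℝ) :
    Tendsto (fun n => charFun (F n) z ^ a n) atTop (𝓝 (Complex.exp (-psi M β z))) := by
  have hphi : Tendsto (fun n => phi (arrayMeasure (a n) (F n)) z) atTop (𝓝 (phi M z)) :=
    hconv.tendsto_integral (fun n => isCanonical_arrayMeasure _ _) hM (continuous_kernel z)
      (norm_kernel_le z)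
  have hpsi : Tendsto (fun n => (a n : ℂ) * (1 - charFun (F n) z)) atTop (𝓝 (psi M β z)) := by
    simp_rw [← psi_arrayMeasure]
    unfold psi
    refine Tendsto.add (Tendsto.mul_const _ (Tendsto.const_mul _ ?_)) hphi
    exact (Complex.continuous_ofReal.tendsto _).comp hβ
  have hexp : Tendsto (fun n => Complex.exp (-((a n : ℂ) * (1 - charFun (F n) z)))) atTop
      (𝓝 (Complex.exp (-psi M β z))) := (Complex.continuous_exp.tendsto _).comp hpsi.neg
  have hinv : Tendsto (fun n => 1 / (a n : ℝ)) atTop (𝓝 0) :=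
    tendsto_one_div_atTop_nhds_zero_nat.comp ha_top
  have hdiff : Tendsto (fun n => charFun (F n) z ^ a n -
      Complex.exp (-((a n : ℂ) * (1 - charFun (F n) z)))) atTop (𝓝 0) := by
    have hlim : Tendsto (fun n => Real.exp 2 * (1 / (a n : ℝ)) *
        ‖(a n : ℂ) * (1 - charFun (F n) z)‖ ^ 2) atTop (𝓝 0) := by
      have := (hinv.const_mul (Real.exp 2)).mul (hpsi.norm.pow 2)
      simpa using this
    refine squeeze_zero_norm' ?_ hlim
    filter_upwards [ha_top.eventually_ge_atTop 2] with n hn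
    -- For a fixed `z` no decay is needed, and `c = 0` asks only for `|f| ≤ 1`.
    have := norm_pow_sub_exp_le (c := 0) le_rfl zero_le_one (norm_charFun_le_one (μ := F n) z)
      (by simpa using norm_charFun_le_one (μ := F n) z) hn
    simpa using this
  simpa using hdiff.add hexp

/-- The quantity `max(γ', γ'', χ, 1/a)` for the row with measure `M' = a u² F(du)`. -/
noncomputable def rateBound (M M' : Measure ℝ) (β β' : ℝ) (k : ℕ) : ℝ :=
  max (max (gammaRe M M') (gammaIm M M')) (max |β' - β| (1 / (k : ℝ)))

lemma norm_psi_sub_le_rateBound {M M' : Measure ℝ} (hM : IsCanonical M) (hM' : IsCanonical M')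
    (β β' z : ℝ) (k : ℕ) :
    ‖psi M' β' z - psi M β z‖ ≤ 3 * rateBound M M' β β' k * (1 + z ^ 2) := by
  refine (norm_psi_sub_le hM hM' β β' z).trans ?_
  have h1 : gammaRe M M' ≤ rateBound M M' β β' k := (le_max_left _ _).trans (le_max_left _ _)
  have h2 : gammaIm M M' ≤ rateBound M M' β β' k := (le_max_right _ _).trans (le_max_left _ _)
  have h3 : |β' - β| ≤ rateBound M M' β β' k := (le_max_left _ _).trans (le_max_right _ _)
  gcongr
  linarith

lemma one_div_le_rateBound (M M' : Measure ℝ) (β β' : ℝ) (k : ℕ) :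
    1 / (k : ℝ) ≤ rateBound M M' β β' k := (le_max_right _ _).trans (le_max_right _ _)

/-- The error in the exponents on the range `|z| ≤ δ b`, for one row of the array. -/
lemma norm_charFun_pow_sub_exp_le {F M : Measure ℝ} [IsProbabilityMeasure F] (hM : IsCanonical M)
    {k : ℕ} (hk : 2 ≤ k) {β z c C A : ℝ} (hc0 : 0 ≤ c) (hc1 : c ≤ 1)
    (hf : ‖charFun F z‖ ≤ Real.exp (-(c * (1 - (charFun F z).re))))
    (hC : ‖psi (arrayMeasure k F) (k * sinMean F) z‖ ≤ C * (1 + z ^ 2))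
    (hdec : ∀ w, w = (phi M z).re ∨ w = (phi (arrayMeasure k F) z).re →
      Real.exp (-(c / 2 * w)) ≤ A * ((1 + z ^ 2) ^ 3)⁻¹) :
    ‖charFun F z ^ k - Complex.exp (-psi M β z)‖ ≤
      (Real.exp 2 * C ^ 2 + 3) * A * rateBound M (arrayMeasure k F) β (k * sinMean F) k *
        (1 + z ^ 2)⁻¹ := by
  set m := rateBound M (arrayMeasure k F) β (k * sinMean F) k with hm
  have hM' := isCanonical_arrayMeasure k F
  have hmk := one_div_le_rateBound M (arrayMeasure k F) β (k * sinMean F) k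
  have hk0 : 0 < 1 / (k : ℝ) := by positivity
  have hm0 : 0 < m := hk0.trans_le hmk
  have hA : 0 ≤ A := by
    have := (Real.exp_pos _).le.trans (hdec _ (Or.inl rfl))
    exact nonneg_of_mul_nonneg_left this (by positivity)
  have h1 := norm_pow_sub_exp_le hc0 hc1 (norm_charFun_le_one z) hf hk
  rw [← psi_arrayMeasure] at h1
  have hre : ∀ w, 0 ≤ w → Real.exp (-w) ≤ Real.exp (-(c / 2 * w)) := fun w hw =>
    Real.exp_le_exp.2 (by nlinarith)
  have h2 := norm_exp_neg_sub_exp_neg_le (x := psi (arrayMeasure k F) (k * sinMean F) z)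
    (y := psi M β z) (m := min (phi M z).re (phi (arrayMeasure k F) z).re)
    (by rw [psi_re]; exact min_le_right _ _) (by rw [psi_re]; exact min_le_left _ _)
  have h3 : Real.exp (-min (phi M z).re (phi (arrayMeasure k F) z).re) ≤
      A * ((1 + z ^ 2) ^ 3)⁻¹ :=
    (hre _ (le_min (phi_re_nonneg hM z) (phi_re_nonneg hM' z))).trans (hdec _ (min_choice _ _))
  have hz1 : 1 ≤ 1 + z ^ 2 := by nlinarith [sq_nonneg z]
  -- The squared exponent costs `(1 + z²)²`, so decay of order `3` leaves one integrable factor.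
  have e1 : ‖charFun F z ^ k - Complex.exp (-psi (arrayMeasure k F) (k * sinMean F) z)‖ ≤
      Real.exp 2 * C ^ 2 * A * m * (1 + z ^ 2)⁻¹ := by
    calc _ ≤ _ := h1
      _ ≤ Real.exp 2 * m * (C * (1 + z ^ 2)) ^ 2 * (A * ((1 + z ^ 2) ^ 3)⁻¹) := by
        rw [psi_re]
        gcongr
        exact hdec _ (Or.inr rfl)
      _ = _ := by field_simp
  have e2 : ‖Complex.exp (-psi (arrayMeasure k F) (k * sinMean F) z) -
      Complex.exp (-psi M β z)‖ ≤ 3 * A * m * (1 + z ^ 2)⁻¹ := by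
    calc _ ≤ _ := h2
      _ ≤ A * ((1 + z ^ 2) ^ 3)⁻¹ * (3 * m * (1 + z ^ 2)) := by
        gcongr
        exact norm_psi_sub_le_rateBound hM hM' β _ z k
      _ = 3 * A * m * ((1 + z ^ 2) ^ 2)⁻¹ := by field_simp
      _ ≤ _ := by
        gcongr
        exact le_self_pow₀ hz1 two_ne_zero
  calc _ ≤ _ := norm_sub_le_norm_sub_add_norm_sub _
        (Complex.exp (-psi (arrayMeasure k F) (k * sinMean F) z)) _
    _ ≤ _ := add_le_add e1 e2
    _ = _ := by ring

lemma integrable_charFun_pow {F : Measure ℝ} [IsProbabilityMeasure F]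
    (h : Integrable fun z : ℝ => ‖charFun F z‖ ^ 2) {k : ℕ} (hk : 2 ≤ k) :
    Integrable fun z : ℝ => charFun F z ^ k := by
  have hc : Continuous fun z : ℝ => charFun F z := continuous_charFun
  refine h.mono' (hc.pow k).aestronglyMeasurable (ae_of_all _ fun z => ?_)
  rw [norm_pow]
  exact pow_le_pow_of_le_one (norm_nonneg _) (norm_charFun_le_one z) hk

lemma integrable_exp_neg_psi {M : Measure ℝ} (hM : IsCanonical M) {β : ℝ} (hB : CondB M β) :
    Integrable fun z : ℝ => Complex.exp (-psi M β z) := by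
  obtain ⟨α, c, R, hα, -, hc, hB⟩ := hB
  obtain ⟨C, -, hC⟩ := exists_exp_neg_le_inv_pow (R := R) hc hα 1
  have := continuous_psi hM β
  refine (integrable_inv_one_add_sq.const_mul C).mono'
    (by fun_prop : Continuous fun z : ℝ => Complex.exp (-psi M β z)).aestronglyMeasurable
    (ae_of_all _ fun z => ?_)
  rw [Complex.norm_exp, Complex.neg_re]
  have h := hC z (psi M β z).re (by rw [psi_re]; exact phi_re_nonneg hM z) (hB z)
  rwa [pow_one] at h

/-- The factor `b` produced here is the one condition E must offset. -/
lemma integral_normSq_charFun_scaledLaw {b : ℝ} (hb : 0 < b) {G : Measure ℝ}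
    (h : Integrable fun z : ℝ => ‖charFun G z‖ ^ 2) :
    Integrable (fun z : ℝ => ‖charFun (scaledLaw b G) z‖ ^ 2) ∧
      ∫ z, ‖charFun (scaledLaw b G) z‖ ^ 2 = b * ∫ z, ‖charFun G z‖ ^ 2 := by
  simp_rw [charFun_scaledLaw]
  refine ⟨h.comp_div hb.ne', ?_⟩
  rw [Measure.integral_comp_div (fun z : ℝ => ‖charFun G z‖ ^ 2), abs_of_pos hb, smul_eq_mul]

/-! ### The L¹ estimate. -/

/-- The `L¹` distance between the characteristic function of `S_n` and `e^{-ψ}` is eventually of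
the order of `max(γ_n', γ_n'', χ_n, 1/a_n)`. -/
theorem eventually_integral_norm_sub_le {a : ℕ → ℕ} {b : ℕ → ℝ} (hb : ∀ n, 0 < b n)
    {G F : ℕ → Measure ℝ} [∀ n, IsProbabilityMeasure (G n)] [∀ n, IsProbabilityMeasure (F n)]
    (hF : ∀ n, F n = scaledLaw (b n) (G n)) {M : Measure ℝ} {β : ℝ} (hM : IsCanonical M)
    (ha_top : Tendsto a atTop atTop)
    (hconv : TendstoProperly (fun n => arrayMeasure (a n) (F n)) M)
    (hβ : Tendsto (fun n => a n * sinMean (F n)) atTop (𝓝 β))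
    {g : ℕ → ℝ → ℝ} (hA : ∀ n, IsDensity (G n) (g n)) (hB : CondB M β) (hC : CondC G)
    (hD : CondD g) (hE : CondE a b) {δ : ℝ} (hδ : 0 < δ) (hFδ : CondF a b F M δ)
    (hGδ : CondG G δ) (hHa : CondH (fun n => (a n : ℝ))) (hHb : CondH b) :
    ∃ C : ℝ, 0 < C ∧ ∀ᶠ n in atTop,
      ∫ z : ℝ, ‖charFun (F n) z ^ a n - Complex.exp (-psi M β z)‖ ≤
        C * rateBound M (arrayMeasure (a n) (F n)) β (a n * sinMean (F n)) (a n) := by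
  obtain ⟨N, hN1, hN⟩ := hC δ hδ
  have hN0 : 0 ≤ N := (norm_nonneg _).trans (hN 0 δ (le_abs_self δ))
  obtain ⟨r, hr, hGr⟩ := hGδ
  obtain ⟨c', hc', hθ⟩ := exists_one_sub_charFun_re_le hδ hr hN1 hN0
  -- The power comparison requires a constant at most `1`.
  set c := min c' 1 with hc
  have hc0 : 0 < c := lt_min hc' one_pos
  have hfF : ∀ n z, charFun (F n) z = charFun (G n) (z / b n) := fun n z => by
    rw [hF n, charFun_scaledLaw]
  have hdivb : ∀ n z, |z / b n| = |z| / b n := fun n z => by rw [abs_div, abs_of_pos (hb n)]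
  have hinner : ∀ n z, |z| ≤ δ * b n →
      ‖charFun (F n) z‖ ≤ Real.exp (-(c * (1 - (charFun (F n) z).re))) := by
    intro n z hz
    have h0 : 0 ≤ 1 - (charFun (F n) z).re := by
      linarith [(Complex.re_le_norm _).trans (norm_charFun_le_one (μ := F n) z)]
    have h1 := hθ (G n) (hN n) (hGr n) (z / b n) (by rw [hdivb, div_le_iff₀ (hb n)]; exact hz)
    rw [← hfF] at h1
    refine h1.trans (Real.exp_le_exp.2 (neg_le_neg ?_))
    gcongr
    exact min_le_left _ _
  obtain ⟨c₀, κ, R, hc₀, hκ, hlow, hlown⟩ := exists_rpow_le_phi_re hM hB hFδ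
  obtain ⟨A, hA0, hdecay⟩ := exists_exp_neg_le_inv_pow (R := R)
    (show 0 < c / 2 * c₀ by positivity) hκ 3
  have hMn : ∀ n, IsCanonical (arrayMeasure (a n) (F n)) := fun n => isCanonical_arrayMeasure _ _
  obtain ⟨C₁, hC₁, hphi⟩ := hconv.exists_norm_phi_le hMn hM
  obtain ⟨C₂, hC₂⟩ := hβ.norm.bddAbove_range
  have hpsi : ∀ n z, ‖psi (arrayMeasure (a n) (F n)) (a n * sinMean (F n)) z‖ ≤
      (C₁ + C₂) * (1 + z ^ 2) := by
    intro n z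
    refine (norm_psi_le (hphi n z) _).trans ?_
    gcongr
    exact hC₂ ⟨n, rfl⟩
  obtain ⟨K, C₃, hC₃, hpoly⟩ := exists_le_pow_of_condH hHa hHb hδ
  -- On the outer range, `K` powers of `1 + z²` pay for `1 / a_n` and one more ensures
  -- integrability.
  obtain ⟨C₄, hC₄, hdecay'⟩ := exists_exp_neg_le_inv_pow (R := R) hc₀ hκ (K + 1)
  obtain ⟨C₅, hC₅, hgeom⟩ := hE.exists_mul_pow_le hb ha_top hN0 hN1
  obtain ⟨B, hB0, hL2⟩ := hD.exists_integral_normSq_charFun_le hA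
  set C₆ := (Real.exp 2 * (C₁ + C₂) ^ 2 + 3) * A with hC₆
  have hC₆0 : 0 < C₆ := by positivity
  refine ⟨(C₆ + C₄ * C₃) * Real.pi + C₅ * B, by positivity, ?_⟩
  filter_upwards [ha_top.eventually_ge_atTop 2, hpoly, hgeom] with n hn hpoly_n hgeom_n
  set m := rateBound M (arrayMeasure (a n) (F n)) β (a n * sinMean (F n)) (a n) with hm
  have hmk : 1 / (a n : ℝ) ≤ m := one_div_le_rateBound _ _ _ _ _
  have ha0 : (0 : ℝ) < a n := by positivity
  have hm0 : 0 < m := (by positivity : 0 < 1 / (a n : ℝ)).trans_le hmk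
  obtain ⟨hL2i, hL2v⟩ := integral_normSq_charFun_scaledLaw (hb n) (hL2 n).1
  rw [← hF n] at hL2i hL2v
  -- the pointwise bound
  have hpt : ∀ z, ‖charFun (F n) z ^ a n - Complex.exp (-psi M β z)‖ ≤
      (C₆ + C₄ * C₃) * m * (1 + z ^ 2)⁻¹ + N ^ (a n - 2) * ‖charFun (F n) z‖ ^ 2 := by
    intro z
    rcases le_or_gt |z| (δ * b n) with hz | hz
    · have h := norm_charFun_pow_sub_exp_le (β := β) (A := A) hM hn hc0.le (min_le_right _ _)
        (hinner n z hz) (hpsi n z) (by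
          rintro w (rfl | rfl)
          · refine hdecay z _ (mul_nonneg (by positivity) (phi_re_nonneg hM z)) fun hR => ?_
            rw [mul_assoc]
            exact mul_le_mul_of_nonneg_left (hlow z hR) (by positivity)
          · refine hdecay z _ (mul_nonneg (by positivity) (phi_re_nonneg (hMn n) z)) fun hR => ?_
            rw [mul_assoc]
            exact mul_le_mul_of_nonneg_left (hlown n z hR hz) (by positivity))
      refine h.trans (le_add_of_le_of_nonneg ?_ (by positivity))
      gcongr
      exact le_add_of_nonneg_right (by positivity)
    -- Outer range: all but two factors are bounded by `N`, and the remaining square is integrable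
    -- by Plancherel.
    · have h1 : ‖charFun (F n) z ^ a n‖ ≤ N ^ (a n - 2) * ‖charFun (F n) z‖ ^ 2 := by
        have hNz : ‖charFun (F n) z‖ ≤ N := by
          rw [hfF]
          refine hN n _ ?_
          rw [hdivb, le_div_iff₀ (hb n)]
          exact hz.le
        rw [norm_pow]
        conv_lhs => rw [show a n = (a n - 2) + 2 by omega, pow_add]
        gcongr
      have h2 : ‖Complex.exp (-psi M β z)‖ ≤ C₄ * C₃ * m * (1 + z ^ 2)⁻¹ := by
        rw [Complex.norm_exp, Complex.neg_re, psi_re]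
        have h3 := hdecay' z _ (phi_re_nonneg hM z) (hlow z)
        have h4 : (a n : ℝ) ≤ C₃ * (1 + z ^ 2) ^ K := by
          refine hpoly_n.trans ?_
          have : (δ * b n) ^ 2 ≤ z ^ 2 := by
            rw [← sq_abs z]
            have := hb n
            gcongr
          gcongr
        have h5 : ((1 + z ^ 2) ^ K)⁻¹ ≤ C₃ * (1 / a n) := by
          rw [mul_one_div, inv_le_comm₀ (by positivity) (by positivity), inv_div,
            div_le_iff₀ hC₃]
          linarith
        calc _ ≤ _ := h3
          _ = C₄ * (((1 + z ^ 2) ^ K)⁻¹ * (1 + z ^ 2)⁻¹) := by rw [pow_succ, mul_inv]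
          _ ≤ C₄ * (C₃ * m * (1 + z ^ 2)⁻¹) := by
            gcongr
            exact h5.trans (by gcongr)
          _ = _ := by ring
      calc _ ≤ _ := norm_sub_le _ _
        _ ≤ N ^ (a n - 2) * ‖charFun (F n) z‖ ^ 2 + C₄ * C₃ * m * (1 + z ^ 2)⁻¹ :=
          add_le_add h1 h2
        _ ≤ _ := by
          rw [add_comm]
          gcongr
          exact le_add_of_nonneg_left hC₆0.le
  have hi1 := integrable_inv_one_add_sq.const_mul ((C₆ + C₄ * C₃) * m)
  have hi2 := hL2i.const_mul (N ^ (a n - 2))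
  calc ∫ z : ℝ, ‖charFun (F n) z ^ a n - Complex.exp (-psi M β z)‖
      ≤ ∫ z : ℝ, ((C₆ + C₄ * C₃) * m * (1 + z ^ 2)⁻¹ +
        N ^ (a n - 2) * ‖charFun (F n) z‖ ^ 2) :=
        integral_mono_of_nonneg (ae_of_all _ fun z => norm_nonneg _) (hi1.add hi2)
          (ae_of_all _ hpt)
    _ = (C₆ + C₄ * C₃) * m * Real.pi +
        N ^ (a n - 2) * b n * ∫ z, ‖charFun (G n) z‖ ^ 2 := by
      rw [integral_add hi1 hi2, integral_const_mul, integral_const_mul,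
        integral_univ_inv_one_add_sq, hL2v, mul_assoc (N ^ (a n - 2))]
    _ ≤ (C₆ + C₄ * C₃) * m * Real.pi + C₅ * m * B := by
      have := (hb n).le
      have h6 : N ^ (a n - 2) * b n ≤ C₅ * m := hgeom_n.trans (by gcongr)
      gcongr
      exact (hL2 n).2
    _ = _ := by ring

/-! ### Row sums and the final assembly. -/

lemma charFun_map_sum_div {Ω : Type*} [MeasurableSpace Ω] {μ : Measure Ω} [IsProbabilityMeasure μ]
    {k : ℕ} {X : Fin k → Ω → ℝ} {G : Measure ℝ} (hlaw : ∀ i, HasLaw (X i) G μ)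
    (hindep : iIndepFun X μ) (b z : ℝ) :
    charFun (μ.map (fun ω => (∑ i, X i ω) / b)) z = charFun (scaledLaw b G) z ^ k := by
  have hm : ∀ i, AEMeasurable (X i) μ := fun i => (hlaw i).aemeasurable
  have hs : AEMeasurable (fun ω => ∑ i, X i ω) μ := by fun_prop
  have h1 := charFun_map_mul_comp hs b⁻¹ z
  have h2 := congrFun (hindep.charFun_map_fun_sum_eq_prod hm) (b⁻¹ * z)
  simp_rw [div_eq_inv_mul]
  rw [h1, h2, charFun_scaledLaw, div_eq_inv_mul]
  simp [fun i => (hlaw i).map_eq]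

end LocalLimit

theorem mainTheorem2
    {Ω : ℕ → Type*} [∀ n, MeasurableSpace (Ω n)]
    (μ : ∀ n, Measure (Ω n)) [∀ n, IsProbabilityMeasure (μ n)]
    (a : ℕ → ℕ) (b : ℕ → ℝ) (ha : ∀ n, 0 < a n) (hb : ∀ n, 0 < b n)
    -- the array: `ξ n k`, `k < a n`, is i.i.d. with law `G n` for each `n`
    (ξ : ∀ n, Fin (a n) → Ω n → ℝ) (G : ℕ → Measure ℝ)
    (hlaw : ∀ n k, HasLaw (ξ n k) (G n) (μ n))
    (hindep : ∀ n, iIndepFun (ξ n) (μ n))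
    -- the laws `F n` of `X_{1,n} = ξ_{1,n} / b_n`, the measures `M_n`, the numbers `β_n`
    (F Mn : ℕ → Measure ℝ) (βn : ℕ → ℝ)
    (hF : ∀ n, F n = LocalLimit.scaledLaw (b n) (G n))
    (hMn : ∀ n, Mn n = LocalLimit.arrayMeasure (a n) (F n))
    (hβn : ∀ n, βn n = LocalLimit.sinMean (F n))
    (M : Measure ℝ) (β : ℝ) (hM : LocalLimit.IsCanonical M)
    (ha_top : Tendsto a atTop atTop)
    (hsmall : ∀ ε : ℝ, 0 < ε → Tendsto (fun n => F n {u | ε ≤ |u|}) atTop (𝓝 0))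
    (hconv : LocalLimit.TendstoProperly Mn M)
    (hβ : Tendsto (fun n => a n * βn n) atTop (𝓝 β))
    -- conditions A to H
    (g : ℕ → ℝ → ℝ) (hA : ∀ n, LocalLimit.IsDensity (G n) (g n))
    (hB : LocalLimit.CondB M β)
    (hC : LocalLimit.CondC G)
    (hD : LocalLimit.CondD g)
    (hE : LocalLimit.CondE a b)
    (δ : ℝ) (hδ : 0 < δ)
    (hFδ : LocalLimit.CondF a b F M δ)
    (hGδ : LocalLimit.CondG G δ)
    (hHa : LocalLimit.CondH (fun n => (a n : ℝ)))
    (hHb : LocalLimit.CondH b) :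
    -- `P` is the law of the limit `S`, `p` its density, `pn n` the density of `S_n`
    ∃ (P : Measure ℝ) (_ : IsProbabilityMeasure P) (p : ℝ → ℝ) (pn : ℕ → ℝ → ℝ),
      TendstoInDistribution (fun n ω => (∑ k, ξ n k ω) / b n) atTop (id : ℝ → ℝ) μ P ∧
      (∀ z : ℝ, charFun P z = Complex.exp (-LocalLimit.psi M β z)) ∧
      LocalLimit.IsDensity P p ∧ Continuous p ∧
      (∀ n, LocalLimit.IsDensity ((μ n).map (fun ω => (∑ k, ξ n k ω) / b n)) (pn n)) ∧
      (∀ n, 2 ≤ a n → Continuous (pn n)) ∧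
      ∃ C : ℝ, 0 < C ∧ ∀ n, 2 ≤ a n → ∀ x : ℝ,
        |pn n x - p x| ≤ C *
          max (max (LocalLimit.gammaRe M (Mn n)) (LocalLimit.gammaIm M (Mn n)))
            (max |a n * βn n - β| (1 / (a n : ℝ))) := by

  have hGp : ∀ n, IsProbabilityMeasure (G n) := fun n =>
    (hlaw n ⟨0, ha n⟩).isProbabilityMeasure_iff.1 inferInstance
  have hFp : ∀ n, IsProbabilityMeasure (F n) := fun n => by rw [hF n]; infer_instance
  obtain rfl : Mn = fun n => LocalLimit.arrayMeasure (a n) (F n) := funext hMn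
  obtain rfl : βn = fun n => LocalLimit.sinMean (F n) := funext hβn
  have hsum : ∀ n, AEMeasurable (fun ω => (∑ k, ξ n k ω) / b n) (μ n) := fun n => by
    have := fun k => (hlaw n k).aemeasurable
    fun_prop
  set L : ℕ → Measure ℝ := fun n => (μ n).map (fun ω => (∑ k, ξ n k ω) / b n) with hL
  have hLp : ∀ n, IsProbabilityMeasure (L n) := fun n => Measure.isProbabilityMeasure_map (hsum n)
  have hLchar : ∀ n z, charFun (L n) z = charFun (F n) z ^ a n := fun n z => by
    rw [hF n]
    exact LocalLimit.charFun_map_sum_div (hlaw n) (hindep n) (b n) z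
  have hlim : ∀ z, Tendsto (fun n => charFun (L n) z) atTop
      (𝓝 (Complex.exp (-LocalLimit.psi M β z))) := fun z => by
    simp_rw [hLchar]
    exact LocalLimit.tendsto_charFun_pow hM ha_top hconv hβ z
  have hcont : Continuous fun z => Complex.exp (-LocalLimit.psi M β z) := by
    have := LocalLimit.continuous_psi hM β
    fun_prop
  obtain ⟨P, hP, hPchar⟩ :=
    LocalLimit.exists_isProbabilityMeasure_charFun_eq hcont.continuousAt hlim
  have hPfun : charFun P = fun z => Complex.exp (-LocalLimit.psi M β z) := funext hPchar
  have hPint : Integrable (charFun P) := by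
    rw [hPfun]; exact LocalLimit.integrable_exp_neg_psi hM hB
  obtain ⟨B, -, hL2⟩ := hD.exists_integral_normSq_charFun_le hA
  have hLint : ∀ n, 2 ≤ a n → Integrable (charFun (L n)) := by
    intro n hn
    rw [show charFun (L n) = fun z => charFun (F n) z ^ a n from funext (hLchar n)]
    refine LocalLimit.integrable_charFun_pow ?_ hn
    rw [hF n]
    exact (LocalLimit.integral_normSq_charFun_scaledLaw (hb n) (hL2 n).1).1
  -- When `a n = 1` the characteristic function need not be integrable, so the rescaled `g n` serves
  -- as density.
  set pn : ℕ → ℝ → ℝ := fun n => if 2 ≤ a n then LocalLimit.invDensity (charFun (L n))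
    else fun x => b n * g n (b n * x) with hpn
  have hpn2 : ∀ n, 2 ≤ a n → pn n = LocalLimit.invDensity (charFun (L n)) := fun n hn => if_pos hn
  refine ⟨P, hP, LocalLimit.invDensity (charFun P), pn, ⟨hsum, by fun_prop, ?_⟩, hPchar,
    LocalLimit.isDensity_invDensity hPint, LocalLimit.continuous_invDensity hPint, fun n => ?_,
    fun n hn => ?_, ?_⟩
  · refine ProbabilityMeasure.tendsto_of_tendsto_charFun fun t => ?_
    simp only [ProbabilityMeasure.coe_mk, Measure.map_id]
    rw [hPchar]
    exact hlim t
  · by_cases hn : 2 ≤ a n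
    · rw [hpn2 n hn]
      exact LocalLimit.isDensity_invDensity (hLint n hn)
    · have ha1 : a n = 1 := by have := ha n; omega
      have hLF : L n = LocalLimit.scaledLaw (b n) (G n) := by
        refine Measure.ext_of_charFun (funext fun z => ?_)
        rw [hLchar, ha1, pow_one, hF n]
      have h : LocalLimit.IsDensity (L n) (pn n) := by
        rw [hLF, show pn n = fun x => b n * g n (b n * x) from if_neg hn]
        exact LocalLimit.isDensity_scaledLaw (hb n) (hA n)
      exact h
  · rw [hpn2 n hn]
    exact LocalLimit.continuous_invDensity (hLint n hn)
  · set m : ℕ → ℝ := fun n => LocalLimit.rateBound M (LocalLimit.arrayMeasure (a n) (F n)) β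
      (a n * LocalLimit.sinMean (F n)) (a n) with hm
    have hm0 : ∀ n, 0 < m n := fun n => by
      have := ha n
      exact (by positivity : (0 : ℝ) < 1 / a n).trans_le
        (LocalLimit.one_div_le_rateBound _ _ _ _ _)
    obtain ⟨C, hC0, hev⟩ := LocalLimit.eventually_integral_norm_sub_le hb hF hM ha_top hconv hβ hA
      hB hC hD hE hδ hFδ hGδ hHa hHb
    set I : ℕ → ℝ := fun n =>
      ∫ z : ℝ, ‖charFun (F n) z ^ a n - Complex.exp (-LocalLimit.psi M β z)‖ with hI
    -- Every `m n` is positive because it is at least `1 / a n`; an eventual bound on the ratio is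
    -- therefore a bound for all `n`, at the price of a larger constant.
    have hbdd : IsBoundedUnder (· ≤ ·) atTop fun n => I n / m n := by
      refine ⟨C, eventually_map.2 ?_⟩
      filter_upwards [hev] with n hn
      rw [div_le_iff₀ (hm0 n)]
      exact hn
    obtain ⟨C', hC'⟩ := hbdd.bddAbove_range
    have hIm : ∀ n, I n ≤ max C' 1 * m n := fun n => by
      rw [← div_le_iff₀ (hm0 n)]
      exact (hC' ⟨n, rfl⟩).trans (le_max_left _ _)
    have hC'0 : 0 < max C' 1 := lt_max_of_lt_right one_pos
    refine ⟨(2 * Real.pi)⁻¹ * max C' 1, by positivity, fun n hn x => ?_⟩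
    rw [hpn2 n hn]
    refine (LocalLimit.abs_invDensity_sub_le (hLint n hn) hPint x).trans ?_
    have hint : ∫ z, ‖charFun (L n) z - charFun P z‖ = I n := by
      simp_rw [hLchar, hPchar]
      rfl
    rw [hint, mul_assoc]
    gcongr
    exact hIm n
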